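/- Let $\Omega$ be a compact metric space, $T:\Omega\to\Omega$ a homeomorphism, $\mu$ a $T$-ergodic ($T$-invariant) Borel probability measure on $\Omega$, and $f:\Omega\to\mathbb D=\{z\in\mathbb C:|z|<1\}$ a continuous function. For $\omega\in\Omega$ and $n\in\mathbb Z$ put $\alpha_n(\omega)=f(T^n\omega)$ and $\rho_n(\omega)=\sqrt{1-|\alpha_n(\omega)|^2}$. Let $\mathcal E(\omega)$ be the associated extended CMV matrix, that is, the unitary operator on $\ell^2(\mathbb Z)$ whose matrix entries (suppressing $\omega$) are, for $m\in\mathbb Z$, $$\mathcal E_{2m,2m-1}=\overline{\alpha_{2m}}\rho_{2m-1},\quad \mathcal E_{2m,2m}=-\overline{\alpha_{2m}}\alpha_{2m-1},\quad \mathcal E_{2m,2m+1}=\overline{\alpha_{2m+1}}\rho_{2m},\quad \mathcal E_{2m,2m+2}=\rho_{2m+1}\rho_{2m},$$ $$\mathcal E_{2m+1,2m-1}=\rho_{2m}\rho_{2m-1},\quad \mathcal E_{2m+1,2m}=-\rho_{2m}\alpha_{2m-1},\quad \mathcal E_{2m+1,2m+1}=-\overline{\alpha_{2m+1}}\alpha_{2m},\quad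 \mathcal E_{2m+1,2m+2}=-\rho_{2m+1}\alpha_{2m},$$ all other entries being $0$. For $N\ge 1$ let $$D_N(z,\omega)=\operatorname{Tr}\left[S(\alpha_N(\omega),z)\cdots S(\alpha_1(\omega),z)\right],\qquad S(\alpha,z)=\frac{1}{\sqrt{1-|\alpha|^2}}\begin{bmatrix} z & -\overline\alpha\\ -\alpha z & 1\end{bmatrix}.$$ Then: 1. For all $\omega\in\Omega$ and $N\ge1$, the function $D_N(\cdot,\omega)$ has exactly $N$ distinct zeros $\xi_1(\omega),\dots,\xi_N(\omega)$ in $\mathbb C$, and they all lie on $\partial\mathbb D$. Let $\nu_{\omega,N}=\frac1N\sum_{n=1}^N\delta_{\xi_n(\omega)}$ be the normalized zero-counting measure. 2. There is a unique finite Borel measure $\kappa$ on $\partial\mathbb D$, the density of states measure, such that for every continuous $g:\partial\mathbb D\to\mathbb C$ the function $\omega\mapsto\langle\delta_0,g(\mathcal E(\omega))\delta_0\rangle$ is $\mu$-integrable and $$\int_{\partial\mathbb D} g\,d\kappa=\int_\Omega\langle\delta_0,g(\mathcal E(\omega))\delta_0\rangle\,d\mu(\omega).$$ 3. For $\mu$-a.e.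 $\omega\in\Omega$, $\nu_{\omega,N}\to\kappa$ weakly as $N\to\infty$. -/

import Mathlib

open MeasureTheory Filter Topology ComplexConjugate
open scoped ENNReal NNReal Matrix

noncomputable section

namespace CMV

/-- The Hilbert space `ℓ²(ℤ)`. -/
abbrev L2Z : Type := lp (fun _ : ℤ => ℂ) 2

/-- The standard basis vector `δ_n` of `ℓ²(ℤ)`. -/
def δ (n : ℤ) : L2Z := lp.single 2 n (1 : ℂ)

/-- `ρ(a) = √(1 - |a|²)`. -/
def ρ (a : Complex.UnitDisc) : ℝ := Real.sqrt (1 - ‖(a : ℂ)‖ ^ 2)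

/-- The matrix entry in row `i`, column `j` of the extended CMV matrix with Verblunsky
coefficients `α`. -/
def entry (α : ℤ → Complex.UnitDisc) (i j : ℤ) : ℂ :=
  if Even i then
    if j = i - 1 then conj (α i : ℂ) * ρ (α (i - 1))
    else if j = i then -(conj (α i : ℂ) * α (i - 1))
    else if j = i + 1 then conj (α (i + 1) : ℂ) * ρ (α i)
    else if j = i + 2 then (ρ (α (i + 1)) : ℂ) * ρ (α i)
    else 0
  else
    if j = i - 2 then (ρ (α (i - 1)) : ℂ) * ρ (α (i - 2))
    else if j = i - 1 then -((ρ (α (i - 1)) : ℂ) * α (i - 2))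
    else if j = i then -(conj (α i : ℂ) * α (i - 1))
    else if j = i + 1 then -((ρ (α i) : ℂ) * α (i - 1))
    else 0

lemma norm_ρ_le (a : Complex.UnitDisc) : ‖(ρ a : ℂ)‖ ≤ 1 := by
  rw [Complex.norm_real, ρ, Real.norm_of_nonneg (Real.sqrt_nonneg _)]
  exact Real.sqrt_le_one.mpr (by nlinarith [sq_nonneg ‖(a : ℂ)‖])

lemma norm_entry_le (α : ℤ → Complex.UnitDisc) (i j : ℤ) : ‖entry α i j‖ ≤ 1 := by
  have hα : ∀ n, ‖(α n : ℂ)‖ ≤ 1 := fun n => (α n).norm_lt_one.le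
  have hρ : ∀ n, ‖(ρ (α n) : ℂ)‖ ≤ 1 := fun n => norm_ρ_le _
  have hm : ∀ x y : ℂ, ‖x‖ ≤ 1 → ‖y‖ ≤ 1 → ‖x * y‖ ≤ 1 := fun x y hx hy => by
    rw [norm_mul]; exact mul_le_one₀ hx (norm_nonneg _) hy
  unfold entry
  split_ifs <;> (try rw [norm_neg]) <;> (try exact norm_zero.trans_le zero_le_one) <;> apply hm <;>
    first | exact hα _ | exact hρ _ | exact (RCLike.norm_conj _).trans_le (hα _)

lemma weightedShift_aux (k : ℤ) (a : ℤ → ℂ) (ha : ∀ n, ‖a n‖ ≤ 1) (u : L2Z) :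
    ∃ h : Memℓp (fun n => a n * u (n + k)) 2, ‖(⟨_, h⟩ : L2Z)‖ ≤ 1 * ‖u‖ := by
  have hu := lp.hasSum_norm (p := 2) (by norm_num) u
  have hs : HasSum (fun n : ℤ => ‖u (n + k)‖ ^ (2 : ℝ≥0∞).toReal)
      (‖u‖ ^ (2 : ℝ≥0∞).toReal) := by
    simpa [Function.comp_def] using (Equiv.addRight k).hasSum_iff.mpr hu
  have hle : ∀ n : ℤ, ‖a n * u (n + k)‖ ^ (2 : ℝ≥0∞).toReal
      ≤ ‖u (n + k)‖ ^ (2 : ℝ≥0∞).toReal := fun n => by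
    refine Real.rpow_le_rpow (norm_nonneg _) ?_ (by norm_num)
    rw [norm_mul]
    exact mul_le_of_le_one_left (norm_nonneg _) (ha n)
  have hmem : Memℓp (fun n => a n * u (n + k)) 2 := by
    refine memℓp_gen (Summable.of_nonneg_of_le (fun n => by positivity) hle hs.summable)
  refine ⟨hmem, ?_⟩
  have h2 := lp.hasSum_norm (p := 2) (by norm_num) (⟨_, hmem⟩ : L2Z)
  have h3 := hasSum_le hle h2 hs
  rw [one_mul]
  exact (Real.rpow_le_rpow_iff (norm_nonneg _) (norm_nonneg _) (by norm_num)).mp h3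

/-- The bounded operator `(A u)(n) = a(n) u(n + k)` on `ℓ²(ℤ)`, for weights `|a(n)| ≤ 1`. -/
def weightedShift (k : ℤ) (a : ℤ → ℂ) (ha : ∀ n, ‖a n‖ ≤ 1) : L2Z →L[ℂ] L2Z :=
  LinearMap.mkContinuous
    { toFun := fun u => ⟨fun n => a n * u (n + k), (weightedShift_aux k a ha u).1⟩
      map_add' := fun u v => by
        ext n
        exact mul_add _ _ _
      map_smul' := fun c u => by
        ext n
        simp only [lp.coeFn_smul, Pi.smul_apply, smul_eq_mul, RingHom.id_apply]
        ring }
    1 (fun u => (weightedShift_aux k a ha u).2)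

/-- The extended CMV matrix with coefficients `α`, as a bounded operator on `ℓ²(ℤ)`: the sum of
its five diagonals. -/
def extended (α : ℤ → Complex.UnitDisc) : L2Z →L[ℂ] L2Z :=
  ∑ k ∈ Finset.Icc (-2 : ℤ) 2,
    weightedShift k (fun n => entry α n (n + k)) (fun n => norm_entry_le α n (n + k))

lemma extended_apply (α : ℤ → Complex.UnitDisc) (u : L2Z) (n : ℤ) :
    extended α u n = ∑ k ∈ Finset.Icc (-2 : ℤ) 2, entry α n (n + k) * u (n + k) := by
  simp only [extended, _root_.sum_apply, lp.coeFn_sum, Finset.sum_apply]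
  rfl

/-- The operator `extended α` has the matrix `entry α`. -/
lemma inner_extended (α : ℤ → Complex.UnitDisc) (i j : ℤ) :
    inner ℂ (δ i) (extended α (δ j)) = entry α i j := by
  have h0 : ∀ x y : ℤ, (δ x : ∀ _ : ℤ, ℂ) y = if y = x then 1 else 0 := fun x y => by
    simp [δ, lp.single_apply, Pi.single_apply]
  rw [δ, lp.inner_single_left, extended_apply]
  simp only [h0, mul_ite, mul_one, mul_zero]
  by_cases hj : j - i ∈ Finset.Icc (-2 : ℤ) 2
  · rw [Finset.sum_eq_single_of_mem (j - i) hj (fun b _ hb => if_neg (by omega))]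
    simp
  · rw [Finset.sum_eq_zero (fun b hb => if_neg (by
      intro h; apply hj; rwa [show j - i = b by omega]))]
    rw [Finset.mem_Icc] at hj
    unfold entry
    split_ifs <;> first | omega | simp

/-- The Szegő transfer matrix `S(a, z)`. -/
def szego (a : Complex.UnitDisc) (z : ℂ) : Matrix (Fin 2) (Fin 2) ℂ :=
  (1 / (ρ a : ℂ)) • !![z, -conj (a : ℂ); -(a : ℂ) * z, 1]

/-- The product `S(α_N, z) ⋯ S(α_1, z)`. -/
def transfer (α : ℤ → Complex.UnitDisc) (z : ℂ) : ℕ → Matrix (Fin 2) (Fin 2) ℂ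
  | 0 => 1
  | N + 1 => szego (α (N + 1)) z * transfer α z N

/-- `D_N(z) = Tr [S(α_N, z) ⋯ S(α_1, z)]`. -/
def discr (α : ℤ → Complex.UnitDisc) (N : ℕ) (z : ℂ) : ℂ := (transfer α z N).trace

/-- The Borel σ-algebra of the unit circle. -/
instance : MeasurableSpace Circle := borel Circle

instance : BorelSpace Circle := ⟨rfl⟩

/-- The unit point mass at `ξ`. -/
def pointMass (ξ : Circle) : FiniteMeasure Circle := ⟨Measure.dirac ξ, inferInstance⟩

/-- The normalized zero-counting measure `N⁻¹ ∑ δ_ξ` on the unit circle, the sum running over the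
zeros `ξ` of `D_N`. -/
def zeroMeasure (α : ℤ → Complex.UnitDisc) (N : ℕ) : FiniteMeasure Circle :=
  (N : ℝ≥0)⁻¹ • ∑ᶠ ξ ∈ {ξ : Circle | discr α N ξ = 0}, pointMass ξ

/-- `g(U)` for a unitary operator `U` and a continuous function `g` on the unit circle, by the
continuous functional calculus (the values of `g` off the circle, which contains the spectrum of
`U`, are irrelevant). -/
def circleCfc (g : C(Circle, ℂ)) (U : L2Z →L[ℂ] L2Z) : L2Z →L[ℂ] L2Z :=
  cfc (Function.extend ((↑) : Circle → ℂ) g 0) U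

section Ergodic

variable {Ω : Type*} [MetricSpace Ω]

/-- The coefficients `α_n(ω) = f(Tⁿ ω)`, `n ∈ ℤ`. -/
def coeff (T : Ω ≃ₜ Ω) (f : C(Ω, Complex.UnitDisc)) (ω : Ω) (n : ℤ) : Complex.UnitDisc :=
  f ((T ^ n) ω)

/-- `κ` is the density of states measure: `∫ g dκ = ∫ ⟨δ_0, g(ℰ(ω)) δ_0⟩ dμ(ω)` for every
continuous `g` on the circle (the integrand on the right being integrable). -/
def IsDensityOfStates [MeasurableSpace Ω] (T : Ω ≃ₜ Ω) (μ : Measure Ω)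
    (f : C(Ω, Complex.UnitDisc)) (κ : FiniteMeasure Circle) : Prop :=
  ∀ g : C(Circle, ℂ),
    Integrable (fun ω => inner ℂ (δ 0) (circleCfc g (extended (coeff T f ω)) (δ 0))) μ ∧
    ∫ z, g z ∂(κ : Measure Circle)
      = ∫ ω, inner ℂ (δ 0) (circleCfc g (extended (coeff T f ω)) (δ 0)) ∂μ

end Ergodic

end CMV

end

/-! Zeros. The Szegő matrices are pseudo-unitary: up to the factor `z` on the first coordinate they
preserve |v₁|² - |v₀|² (`normSq_szego_mulVec`). If D_N(z) = 0, the transfer matrix A satisfies A² =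
-z^N, and for |z| ≠ 1 this contradicts the monotonicity of the form. On the circle, with J = diag(1,
-1), A J A* = J and z A' = A J G, where G is a sum of rank-one positive matrices; this rules out tr
A = tr A' = 0, so the zeros are simple. Up to a nonzero constant D_N is a monic polynomial of degree
N, hence it has N zeros.

Moments. For N-periodic coefficients, every Szegő solution at a zero ξ of D_N gives a
2N-antiperiodic eigensequence of ℰ. Each ξ contributes two dimensions, so the N zeros diagonalize ℰ
on the 2N-dimensional antiperiodic space, and tr ℰ^k = 2 ∑ ξ^k. For k < N the band of ℰ^k does not
wrap around, so this trace is a sum of diagonal entries (`sum_zeros_pow_eq`). Periodizing arbitrary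
coefficients changes only O(k) of these entries (`norm_sum_zeros_pow_sub_le`), which is negligible
after division by N.

Convergence. Shifting the coefficients by one step transposes ℰ and shifts its indices, so the j-th
diagonal entry of ℰ(ω)^k is the 0-th one at T^j ω. The averages are thus Birkhoff averages, and the
pointwise ergodic theorem gives their limit, the k-th moment of κ. Conjugation supplies the negative
moments, and trigonometric polynomials are uniformly dense. The measure κ itself comes from Riesz
representation, applied to the μ-average of the positive functionals g ↦ ⟨δ₀, g(ℰ(ω)) δ₀⟩, which are
continuous in ω. -/

noncomputable section

/-! ### The pointwise ergodic theorem -/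

section Birkhoff

variable {X : Type*}

/-- The running maximum `max (0, S₁ f, …, S_n f)` of the Birkhoff sums of `f`. -/
def birkhoffMax (T : X → X) (f : X → ℝ) : ℕ → X → ℝ
  | 0 => fun _ => 0
  | n + 1 => fun x => max 0 (f x + birkhoffMax T f n (T x))

lemma birkhoffMax_nonneg (T : X → X) (f : X → ℝ) (n : ℕ) (x : X) : 0 ≤ birkhoffMax T f n x := by
  cases n with
  | zero => exact le_rfl
  | succ n => exact le_max_left _ _

lemma birkhoffMax_le_succ (T : X → X) (f : X → ℝ) (n : ℕ) (x : X) :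
    birkhoffMax T f n x ≤ birkhoffMax T f (n + 1) x := by
  induction n generalizing x with
  | zero => exact le_max_left _ _
  | succ n ih => exact max_le_max le_rfl (add_le_add le_rfl (ih (T x)))

lemma birkhoffSum_le_birkhoffMax (T : X → X) (f : X → ℝ) (n : ℕ) (x : X) :
    birkhoffSum T f n x ≤ birkhoffMax T f n x := by
  induction n generalizing x with
  | zero => simp [birkhoffMax]
  | succ n ih =>
    rw [birkhoffSum_succ']
    exact (add_le_add le_rfl (ih (T x))).trans (le_max_right _ _)

variable [MeasurableSpace X] {μ : Measure X}

lemma measurable_birkhoffMax {T : X → X} {f : X → ℝ} (hT : Measurable T) (hf : Measurable f)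
    (n : ℕ) : Measurable (birkhoffMax T f n) := by
  induction n with
  | zero => exact measurable_const
  | succ n ih => exact measurable_const.max (hf.add (ih.comp hT))

lemma integrable_birkhoffMax {T : X → X} {f : X → ℝ} (hT : MeasurePreserving T μ μ)
    (hf : Integrable f μ) (n : ℕ) : Integrable (birkhoffMax T f n) μ := by
  induction n with
  | zero => exact integrable_zero _ _ _
  | succ n ih => exact (integrable_zero _ _ _).sup (hf.add (hT.integrable_comp_of_integrable ih))

/-- Maximal ergodic inequality. -/
lemma setIntegral_birkhoffMax_pos_nonneg {T : X → X} {f : X → ℝ} (hT : MeasurePreserving T μ μ)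
    (hfm : Measurable f) (hf : Integrable f μ) (n : ℕ) :
    0 ≤ ∫ x in {x | 0 < birkhoffMax T f n x}, f x ∂μ := by
  set M := birkhoffMax T f n with hM
  have hMi : Integrable M μ := integrable_birkhoffMax hT hf n
  have hMT : Integrable (fun x => M (T x)) μ := hT.integrable_comp_of_integrable hMi
  have hs : MeasurableSet {x | 0 < M x} :=
    measurableSet_lt measurable_const (measurable_birkhoffMax hT.measurable hfm n)
  -- Where the maximum is positive it is not attained by 0, so it equals f plus the previous maximum
  -- at T x, which is at most f x + M (T x).
  have h1 : ∫ x in {x | 0 < M x}, (M x - M (T x)) ∂μ ≤ ∫ x in {x | 0 < M x}, f x ∂μ := by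
    refine setIntegral_mono_on (hMi.sub hMT).integrableOn hf.integrableOn hs fun x hx => ?_
    have hx : 0 < M x := hx
    cases n with
    | zero => exact absurd hx (lt_irrefl _)
    | succ n =>
      have h2 : M x = max 0 (f x + birkhoffMax T f n (T x)) := rfl
      have h3 := birkhoffMax_le_succ T f n (T x)
      rw [h2] at hx ⊢
      rcases le_total (f x + birkhoffMax T f n (T x)) 0 with h | h
      · rw [max_eq_left h] at hx; exact absurd hx (lt_irrefl _)
      · rw [max_eq_right h]; linarith
  refine le_trans ?_ h1
  rw [integral_sub hMi.integrableOn hMT.integrableOn]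
  have h4 : ∫ x in {x | 0 < M x}, M x ∂μ = ∫ x, M x ∂μ :=
    setIntegral_eq_integral_of_forall_compl_eq_zero fun x hx =>
      le_antisymm (not_lt.mp hx) (birkhoffMax_nonneg T f n x)
  have h5 : ∫ x in {x | 0 < M x}, M (T x) ∂μ ≤ ∫ x, M (T x) ∂μ :=
    setIntegral_le_integral hMT (ae_of_all _ fun x => birkhoffMax_nonneg T f n (T x))
  have h6 : ∫ x, M (T x) ∂μ = ∫ x, M x ∂μ := by
    have := integral_map (μ := μ) hT.measurable.aemeasurable (f := M)
      (by rw [hT.map_eq]; exact hMi.aestronglyMeasurable)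
    rw [hT.map_eq] at this
    exact this.symm
  linarith

/-- The sets in the maximal inequality increase to a set of full measure, so the inequality passes
to the limit. -/
lemma integral_nonneg_of_ae_exists_birkhoffSum_pos {T : X → X} {f : X → ℝ}
    (hT : MeasurePreserving T μ μ) (hfm : Measurable f) (hf : Integrable f μ)
    (h : ∀ᵐ x ∂μ, ∃ n, 0 < birkhoffSum T f n x) : 0 ≤ ∫ x, f x ∂μ := by
  have hmono : Monotone fun n => {x | 0 < birkhoffMax T f n x} :=
    monotone_nat_of_le_succ fun n x hx => lt_of_lt_of_le hx (birkhoffMax_le_succ T f n x)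
  have hlim := tendsto_setIntegral_of_monotone (μ := μ) (f := f)
    (fun n => measurableSet_lt measurable_const (measurable_birkhoffMax hT.measurable hfm n))
    hmono hf.integrableOn
  have huniv : (⋃ n, {x | 0 < birkhoffMax T f n x}) =ᵐ[μ] Set.univ := by
    filter_upwards [h] with x hx
    obtain ⟨n, hn⟩ := hx
    refine propext (iff_of_true ?_ trivial)
    exact Set.mem_iUnion.mpr ⟨n, hn.trans_le (birkhoffSum_le_birkhoffMax T f n x)⟩
  rw [setIntegral_congr_set huniv, setIntegral_univ] at hlim
  exact ge_of_tendsto' hlim fun n => setIntegral_birkhoffMax_pos_nonneg hT hfm hf n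

/-- Unboundedness above of the sums is a T-invariant property, so by ergodicity it holds almost
nowhere or almost everywhere; the latter would make some sum positive almost everywhere and force ∫
f ≥ 0. -/
lemma ae_bddAbove_birkhoffSum {T : X → X} {f : X → ℝ}
    (hT : Ergodic T μ) (hfm : Measurable f) (hf : Integrable f μ) (hneg : ∫ x, f x ∂μ < 0) :
    ∀ᵐ x ∂μ, ∃ K : ℕ, ∀ n, birkhoffSum T f n x ≤ K := by
  set A : Set X := {x | ∀ K : ℕ, ∃ n, (K : ℝ) < birkhoffSum T f n x} with hA
  have hSm : ∀ n, Measurable (birkhoffSum T f n) := fun n => by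
    unfold birkhoffSum
    exact Finset.measurable_sum _ fun k _ => hfm.comp (hT.measurable.iterate k)
  have hAm : MeasurableSet A := by
    have : A = ⋂ K : ℕ, ⋃ n, {x | (K : ℝ) < birkhoffSum T f n x} := by ext; simp [hA]
    rw [this]
    exact MeasurableSet.iInter fun K => MeasurableSet.iUnion fun n =>
      measurableSet_lt measurable_const (hSm n)
  have hinv : T ⁻¹' A = A := by
    ext x
    simp only [Set.mem_preimage, hA, Set.mem_ofPred_eq]
    constructor
    · intro h K
      obtain ⟨K', hK'⟩ := exists_nat_gt ((K : ℝ) - f x)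
      obtain ⟨n, hn⟩ := h K'
      exact ⟨n + 1, by rw [birkhoffSum_succ']; linarith⟩
    · intro h K
      obtain ⟨K', hK'⟩ := exists_nat_gt ((K : ℝ) + f x)
      obtain ⟨n, hn⟩ := h K'
      cases n with
      | zero => exact absurd hn (by simp)
      | succ n =>
        rw [birkhoffSum_succ'] at hn
        exact ⟨n, by linarith⟩
  rcases hT.toPreErgodic.ae_empty_or_univ hAm hinv with h | h
  · filter_upwards [h] with x hx
    have hx : ¬ x ∈ A := fun hx' => (hx.mp hx' : x ∈ (∅ : Set X))
    simpa [hA] using hx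
  · refine absurd (integral_nonneg_of_ae_exists_birkhoffSum_pos hT.toMeasurePreserving hfm hf ?_)
      (not_le.mpr hneg)
    filter_upwards [h] with x hx
    have hx : x ∈ A := hx.mpr trivial
    simpa using hx 0

lemma ae_eventually_birkhoffAverage_lt [IsProbabilityMeasure μ] {T : X → X} {f : X → ℝ}
    (hT : Ergodic T μ) (hfm : Measurable f) (hf : Integrable f μ) {c : ℝ}
    (hc : ∫ x, f x ∂μ < c) :
    ∀ᵐ x ∂μ, ∀ᶠ n in atTop, birkhoffAverage ℝ T f n x < c := by
  -- Subtracting d makes the integral negative, so S_n f ≤ K + n d; the average drops below c once n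
  -- > K / (c - d).
  obtain ⟨d, hd, hdc⟩ := exists_between hc
  have h := ae_bddAbove_birkhoffSum hT (f := fun x => f x - d) (hfm.sub_const d)
    (hf.sub (integrable_const d)) (by
      rw [integral_sub hf (integrable_const d)]; simp; linarith)
  filter_upwards [h] with x ⟨K, hK⟩
  obtain ⟨m, hm⟩ := exists_nat_gt ((K : ℝ) / (c - d))
  filter_upwards [eventually_ge_atTop (m + 1)] with n hn
  have hn0 : (0 : ℝ) < n := by exact_mod_cast (by omega : 0 < n)
  have h1 := hK n
  have h2 : birkhoffSum T (fun x => f x - d) n x = birkhoffSum T f n x - n * d := by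
    simp [birkhoffSum, Finset.sum_sub_distrib]
  rw [h2] at h1
  rw [div_lt_iff₀ (by linarith)] at hm
  have h3 : (m : ℝ) < n := by exact_mod_cast (by omega : m < n)
  rw [birkhoffAverage, smul_eq_mul, inv_mul_lt_iff₀ hn0]
  nlinarith

/-- The pointwise ergodic theorem. -/
theorem ae_tendsto_birkhoffAverage [IsProbabilityMeasure μ] {T : X → X} {f : X → ℝ}
    (hT : Ergodic T μ) (hfm : Measurable f) (hf : Integrable f μ) :
    ∀ᵐ x ∂μ, Tendsto (fun n => birkhoffAverage ℝ T f n x) atTop (𝓝 (∫ x, f x ∂μ)) := by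
  have h1 : ∀ᵐ x ∂μ, ∀ k : ℕ, ∀ᶠ n in atTop,
      birkhoffAverage ℝ T f n x < ∫ x, f x ∂μ + 1 / ((k : ℝ) + 1) :=
    ae_all_iff.mpr fun k => ae_eventually_birkhoffAverage_lt hT hfm hf
      (lt_add_of_pos_right _ Nat.one_div_pos_of_nat)
  have h2 : ∀ᵐ x ∂μ, ∀ k : ℕ, ∀ᶠ n in atTop,
      birkhoffAverage ℝ T (fun x => - f x) n x < ∫ x, - f x ∂μ + 1 / ((k : ℝ) + 1) :=
    ae_all_iff.mpr fun k => ae_eventually_birkhoffAverage_lt hT hfm.neg hf.neg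
      (lt_add_of_pos_right _ Nat.one_div_pos_of_nat)
  filter_upwards [h1, h2] with x h1 h2
  refine Metric.tendsto_atTop'.mpr fun ε hε => ?_
  obtain ⟨k, hk⟩ := exists_nat_one_div_lt hε
  obtain ⟨N, hN⟩ := eventually_atTop.mp ((h1 k).and (h2 k))
  refine ⟨N, fun n hn => ?_⟩
  obtain ⟨h3, h4⟩ := hN n hn.le
  have h5 : birkhoffAverage ℝ T (fun x => - f x) n x = - birkhoffAverage ℝ T f n x := by
    simp [birkhoffAverage, birkhoffSum]
  rw [h5, integral_neg] at h4
  rw [Real.dist_eq, abs_lt]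
  constructor <;> linarith

theorem ae_tendsto_birkhoffAverage_complex [IsProbabilityMeasure μ] {T : X → X} {f : X → ℂ}
    (hT : Ergodic T μ) (hfm : Measurable f) (hf : Integrable f μ) :
    ∀ᵐ x ∂μ, Tendsto (fun n => birkhoffAverage ℂ T f n x) atTop (𝓝 (∫ x, f x ∂μ)) := by
  filter_upwards [ae_tendsto_birkhoffAverage hT (Complex.measurable_re.comp hfm) hf.re,
    ae_tendsto_birkhoffAverage hT (Complex.measurable_im.comp hfm) hf.im] with x h1 h2
  have h3 : ∫ x, f x ∂μ = ((∫ x, (f x).re ∂μ : ℝ) : ℂ) + ((∫ x, (f x).im ∂μ : ℝ) : ℂ) * Complex.I :=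
    (integral_re_add_im hf).symm
  rw [h3]
  refine (((Complex.continuous_ofReal.tendsto _).comp h1).add
    (((Complex.continuous_ofReal.tendsto _).comp h2).mul_const Complex.I)).congr fun n => ?_
  apply Complex.ext <;> simp [birkhoffAverage, birkhoffSum, ← Complex.ofReal_natCast,
    ← Complex.ofReal_inv]

end Birkhoff

namespace CMV

/-! ### Transfer matrices and the location of the zeros -/

lemma ρ_sq (a : Complex.UnitDisc) : ρ a ^ 2 = 1 - ‖(a : ℂ)‖ ^ 2 := by
  refine Real.sq_sqrt ?_
  have := a.norm_lt_one
  nlinarith [norm_nonneg (a : ℂ)]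

lemma ρ_pos (a : Complex.UnitDisc) : 0 < ρ a := by
  refine Real.sqrt_pos.mpr ?_
  have := a.norm_lt_one
  nlinarith [norm_nonneg (a : ℂ)]

lemma ρ_ne_zero (a : Complex.UnitDisc) : (ρ a : ℂ) ≠ 0 := by exact_mod_cast (ρ_pos a).ne'

lemma ρ_mul_self (a : Complex.UnitDisc) : (ρ a : ℂ) * ρ a = 1 - a * conj (a : ℂ) := by
  rw [Complex.mul_conj, Complex.normSq_eq_norm_sq]
  exact_mod_cast (sq (ρ a)).symm.trans (ρ_sq a)

lemma det_szego (a : Complex.UnitDisc) (z : ℂ) : (szego a z).det = z := by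
  have h := ρ_mul_self a
  have h0 := ρ_ne_zero a
  rw [szego, Matrix.det_smul, Matrix.det_fin_two_of, Fintype.card_fin]
  field_simp
  linear_combination (-z) * h

lemma det_transfer (α : ℤ → Complex.UnitDisc) (z : ℂ) (N : ℕ) : (transfer α z N).det = z ^ N := by
  induction N with
  | zero => simp [transfer]
  | succ N ih => rw [transfer, Matrix.det_mul, det_szego, ih, pow_succ']

lemma szego_mulVec (a : Complex.UnitDisc) (z : ℂ) (v : Fin 2 → ℂ) :
    szego a z *ᵥ v = ![(z * v 0 - conj (a : ℂ) * v 1) / ρ a, (v 1 - a * z * v 0) / ρ a] := by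
  ext i
  fin_cases i <;> simp [szego, Matrix.mulVec, dotProduct, Fin.sum_univ_two] <;> ring

/-- The Szegő matrix is diag(z, 1) followed by an element of SU(1,1), which preserves the indefinite
form. -/
lemma normSq_szego_mulVec (a : Complex.UnitDisc) (z : ℂ) (v : Fin 2 → ℂ) :
    Complex.normSq ((szego a z *ᵥ v) 1) - Complex.normSq ((szego a z *ᵥ v) 0)
      = Complex.normSq (v 1) - Complex.normSq z * Complex.normSq (v 0) := by
  have h := ρ_sq a
  have h0 := (ρ_pos a).ne'
  rw [← Complex.normSq_eq_norm_sq] at h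
  rw [← Complex.normSq_mul z, szego_mulVec, mul_assoc]
  generalize z * v 0 = w
  simp only [Matrix.cons_val_zero, Matrix.cons_val_one, Complex.normSq_div, Complex.normSq_ofReal]
  rw [← sq, h, ← sub_div, div_eq_iff (h ▸ pow_ne_zero 2 h0)]
  simp only [Complex.normSq_apply, Complex.sub_re, Complex.sub_im, Complex.mul_re, Complex.mul_im,
    Complex.conj_re, Complex.conj_im]
  ring

lemma transfer_succ_mulVec (α : ℤ → Complex.UnitDisc) (z : ℂ) (N : ℕ) (v : Fin 2 → ℂ) :
    transfer α z (N + 1) *ᵥ v = szego (α (N + 1)) z *ᵥ (transfer α z N *ᵥ v) := by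
  rw [transfer, Matrix.mulVec_mulVec]

lemma le_form_transfer_of_norm_le_one (α : ℤ → Complex.UnitDisc) {z : ℂ}
    (hz : Complex.normSq z ≤ 1) (N : ℕ) (v : Fin 2 → ℂ) :
    Complex.normSq (v 1) - Complex.normSq (v 0)
      ≤ Complex.normSq ((transfer α z N *ᵥ v) 1) - Complex.normSq ((transfer α z N *ᵥ v) 0) := by
  induction N with
  | zero => simp [transfer]
  | succ N ih =>
    rw [transfer_succ_mulVec, normSq_szego_mulVec]
    nlinarith [Complex.normSq_nonneg ((transfer α z N *ᵥ v) 0)]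

lemma le_form_transfer_of_one_le_norm (α : ℤ → Complex.UnitDisc) {z : ℂ}
    (hz : 1 ≤ Complex.normSq z) (N : ℕ) (v : Fin 2 → ℂ) :
    Complex.normSq z ^ N * (Complex.normSq (v 0) - Complex.normSq (v 1))
      ≤ Complex.normSq ((transfer α z N *ᵥ v) 0) - Complex.normSq ((transfer α z N *ᵥ v) 1) := by
  induction N with
  | zero => simp [transfer]
  | succ N ih =>
    rw [transfer_succ_mulVec, ← neg_sub (Complex.normSq ((szego _ z *ᵥ _) 1)), normSq_szego_mulVec,
      pow_succ', mul_assoc]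
    nlinarith [Complex.normSq_nonneg ((transfer α z N *ᵥ v) 1),
      mul_le_mul_of_nonneg_left ih (Complex.normSq_nonneg z)]

/-- Cayley–Hamilton for a traceless matrix of determinant z^N. -/
lemma transfer_mul_self {α : ℤ → Complex.UnitDisc} {z : ℂ} {N : ℕ} (h : discr α N z = 0) :
    transfer α z N * transfer α z N = (-z ^ N) • (1 : Matrix (Fin 2) (Fin 2) ℂ) := by
  have hd := det_transfer α z N
  rw [Matrix.det_fin_two] at hd
  rw [discr, Matrix.trace_fin_two] at h
  set A := transfer α z N
  have hA : A 1 1 = - A 0 0 := by linear_combination h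
  rw [hA] at hd
  ext i j
  fin_cases i <;> fin_cases j <;> simp [Matrix.mul_apply, Fin.sum_univ_two, hA, ← hd] <;> ring

/-- Two passes through the transfer matrix multiply a basis vector by -z^N. Inside the disc,
monotonicity of the form at (0, 1) would give 1 ≤ |z|^(2N); outside, its growth at (1, 0) would give
|z|^(4N) ≤ |z|^(2N). -/
lemma norm_eq_one_of_discr_eq_zero {α : ℤ → Complex.UnitDisc} {z : ℂ} {N : ℕ} (hN : 0 < N)
    (h : discr α N z = 0) : ‖z‖ = 1 := by
  have hsq : ∀ e : Fin 2 → ℂ, transfer α z N *ᵥ (transfer α z N *ᵥ e) = (-z ^ N) • e := fun e => by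
    rw [Matrix.mulVec_mulVec, transfer_mul_self h, Matrix.smul_mulVec, Matrix.one_mulVec]
  have key : Complex.normSq z = 1 := by
    have h0 := Complex.normSq_nonneg z
    rcases lt_trichotomy (Complex.normSq z) 1 with hlt | heq | hgt
    · have h1 := le_form_transfer_of_norm_le_one α hlt.le N ![0, 1]
      have h2 := h1.trans (le_form_transfer_of_norm_le_one α hlt.le N _)
      rw [hsq] at h2
      simp at h2
      exact absurd (pow_lt_one₀ h0 hlt hN.ne') (not_lt.mpr h2)
    · exact heq
    · have h1 := le_form_transfer_of_one_le_norm α hgt.le N ![1, 0]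
      have h2 := le_form_transfer_of_one_le_norm α hgt.le N (transfer α z N *ᵥ ![1, 0])
      rw [hsq] at h2
      have h3 := one_lt_pow₀ hgt hN.ne'
      simp at h1 h2
      nlinarith
  rw [Complex.normSq_eq_norm_sq] at key
  exact (pow_eq_one_iff_of_nonneg (norm_nonneg z) two_ne_zero).mp key

/-! ### Degree of the discriminant and simplicity of its zeros -/

/-- The polynomial `∏ ρ(α_n) · D_N`, as the trace of a product of polynomial matrices. -/
def polyTransfer (α : ℤ → Complex.UnitDisc) : ℕ → Matrix (Fin 2) (Fin 2) (Polynomial ℂ)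
  | 0 => 1
  | N + 1 => !![.X, -.C (conj (α (N + 1) : ℂ)); -.C (α (N + 1) : ℂ) * .X, 1] * polyTransfer α N

lemma exists_transfer_eq_smul (α : ℤ → Complex.UnitDisc) (N : ℕ) :
    ∃ c : ℂ, c ≠ 0 ∧ ∀ z i j, transfer α z N i j = c * (polyTransfer α N i j).eval z := by
  induction N with
  | zero =>
    refine ⟨1, one_ne_zero, fun z i j => ?_⟩
    fin_cases i <;> fin_cases j <;> simp [transfer, polyTransfer]
  | succ N ih =>
    obtain ⟨c, hc, h⟩ := ih
    refine ⟨1 / ρ (α (N + 1)) * c, mul_ne_zero (one_div_ne_zero (ρ_ne_zero _)) hc, fun z i j => ?_⟩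
    fin_cases i <;> fin_cases j <;>
      simp [transfer, polyTransfer, szego, Matrix.mul_apply, Fin.sum_univ_two, h] <;> ring

-- Only the (0, 0) entry carries the leading term X^N of the trace. The strict bound on the (1, 1)
-- entry fails for the identity matrix at N = 0, hence the two separate clauses for it.
open Polynomial in
lemma polyTransfer_degree (α : ℤ → Complex.UnitDisc) (N : ℕ) :
    (polyTransfer α N 0 0 - X ^ N).degree < (N : WithBot ℕ) ∧
      (polyTransfer α N 0 1).degree < (N : WithBot ℕ) ∧
      (polyTransfer α N 1 0).degree ≤ (N : WithBot ℕ) ∧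
      (polyTransfer α N 1 1).degree ≤ (N : WithBot ℕ) ∧
      (0 < N → (polyTransfer α N 1 1).degree < (N : WithBot ℕ)) := by
  induction N with
  | zero => simp [polyTransfer]
  | succ N ih =>
    obtain ⟨h1, h2, h3, h4, -⟩ := ih
    have hX : ∀ p : ℂ[X], p.degree < (N : WithBot ℕ) → (X * p).degree < ((N + 1 : ℕ) : WithBot ℕ) := fun p hp => by
      rw [degree_mul, degree_X, Nat.cast_add, Nat.cast_one, add_comm]
      by_cases h : p = 0
      · simp only [h, degree_zero, WithBot.bot_add]; exact WithBot.bot_lt_coe _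
      · rw [degree_eq_natDegree h] at hp ⊢
        have : p.natDegree < N := by exact_mod_cast hp
        exact_mod_cast (by omega : p.natDegree + 1 < N + 1)
    have hN : ((N : ℕ) : WithBot ℕ) < ((N + 1 : ℕ) : WithBot ℕ) := by exact_mod_cast Nat.lt_succ_self N
    have hC : ∀ (c : ℂ) (p : ℂ[X]) (b : WithBot ℕ), p.degree < b → (C c * p).degree < b :=
      fun c p b hp => by
        rw [← smul_eq_C_mul]; exact (degree_smul_le c p).trans_lt hp
    have e11 : (polyTransfer α (N + 1) 1 1).degree < ((N + 1 : ℕ) : WithBot ℕ) := by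
      have : polyTransfer α (N + 1) 1 1
          = C (-(α (N + 1) : ℂ)) * (X * polyTransfer α N 0 1) + polyTransfer α N 1 1 := by
        simp [polyTransfer, Matrix.mul_apply, Fin.sum_univ_two]; ring
      rw [this]
      exact (degree_add_le _ _).trans_lt (max_lt (hC _ _ _ (hX _ h2)) (h4.trans_lt hN))
    refine ⟨?_, ?_, ?_, e11.le, fun _ => e11⟩
    · have : polyTransfer α (N + 1) 0 0 - X ^ (N + 1)
          = X * (polyTransfer α N 0 0 - X ^ N)
            + C (-conj (α (N + 1) : ℂ)) * polyTransfer α N 1 0 := by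
        simp [polyTransfer, Matrix.mul_apply, Fin.sum_univ_two]; ring
      rw [this]
      exact (degree_add_le _ _).trans_lt (max_lt (hX _ h1) (hC _ _ _ (h3.trans_lt hN)))
    · have : polyTransfer α (N + 1) 0 1
          = X * polyTransfer α N 0 1 + C (-conj (α (N + 1) : ℂ)) * polyTransfer α N 1 1 := by
        simp [polyTransfer, Matrix.mul_apply, Fin.sum_univ_two]
      rw [this]
      exact (degree_add_le _ _).trans_lt (max_lt (hX _ h2) (hC _ _ _ (h4.trans_lt hN)))
    · have : polyTransfer α (N + 1) 1 0
          = C (-(α (N + 1) : ℂ)) * (X * (polyTransfer α N 0 0 - X ^ N)) + polyTransfer α N 1 0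
            + C (-(α (N + 1) : ℂ)) * X ^ (N + 1) := by
        simp [polyTransfer, Matrix.mul_apply, Fin.sum_univ_two]; ring
      rw [this]
      refine (degree_add_le _ _).trans (max_le ((degree_add_le _ _).trans (max_le
        (hC _ _ _ (hX _ h1)).le (h3.trans hN.le))) (degree_C_mul_X_pow_le _ _))

open Polynomial in
lemma polyTransfer_trace_monic (α : ℤ → Complex.UnitDisc) {N : ℕ} (hN : 0 < N) :
    (polyTransfer α N).trace.Monic ∧ (polyTransfer α N).trace.natDegree = N := by
  obtain ⟨h1, -, -, -, h2⟩ := polyTransfer_degree α N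
  have h : (polyTransfer α N).trace
      = X ^ N + ((polyTransfer α N 0 0 - X ^ N) + polyTransfer α N 1 1) := by
    rw [Matrix.trace_fin_two]; ring
  have hlt : ((polyTransfer α N 0 0 - X ^ N) + polyTransfer α N 1 1).degree < (N : WithBot ℕ) :=
    (degree_add_le _ _).trans_lt (max_lt h1 (h2 hN))
  rw [h]
  exact ⟨monic_X_pow_add hlt, natDegree_eq_of_degree_eq_some (by
    rw [degree_add_eq_left_of_degree_lt (by simpa using hlt), degree_X_pow])⟩

/-- The derivative of the transfer matrix with respect to the spectral parameter. -/
def transferDeriv (α : ℤ → Complex.UnitDisc) (z : ℂ) : ℕ → Matrix (Fin 2) (Fin 2) ℂ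
  | 0 => 0
  | N + 1 => ((1 / (ρ (α (N + 1)) : ℂ)) • !![1, 0; -(α (N + 1) : ℂ), 0]) * transfer α z N
      + szego (α (N + 1)) z * transferDeriv α z N

lemma hasDerivAt_transfer (α : ℤ → Complex.UnitDisc) (z : ℂ) (N : ℕ) (i j : Fin 2) :
    HasDerivAt (fun z => transfer α z N i j) (transferDeriv α z N i j) z := by
  induction N generalizing i j with
  | zero => exact hasDerivAt_const _ _
  | succ N ih =>
    have hS : ∀ k, HasDerivAt (fun z => szego (α (N + 1)) z i k)
        (((1 / (ρ (α (N + 1)) : ℂ)) • !![1, 0; -(α (N + 1) : ℂ), 0]) i k) z := by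
      intro k
      fin_cases i <;> fin_cases k <;>
        simp only [szego, Matrix.smul_apply, smul_eq_mul, Fin.zero_eta, Fin.mk_one,
          Matrix.of_apply, Matrix.cons_val_zero, Matrix.cons_val_one, Matrix.cons_val']
      · exact (hasDerivAt_id z).const_mul _
      · simpa using hasDerivAt_const z _
      · simpa using ((hasDerivAt_id z).const_mul (-(α (N + 1) : ℂ))).const_mul
          (1 / (ρ (α (N + 1)) : ℂ))
      · simpa using hasDerivAt_const z _
    have h := ((hS 0).mul (ih 0 j)).add ((hS 1).mul (ih 1 j))
    simp only [transfer, transferDeriv, Matrix.mul_apply, Matrix.add_apply, Fin.sum_univ_two]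
    refine h.congr_deriv ?_
    ring

lemma szego_conj_form (a : Complex.UnitDisc) {z : ℂ} (hz : z * conj z = 1) :
    szego a z * !![1, 0; 0, -1] * (szego a z)ᴴ = !![1, 0; 0, -1] := by
  have h := ρ_mul_self a
  have h0 := ρ_ne_zero a
  ext i j
  fin_cases i <;> fin_cases j <;>
    simp [szego, Matrix.mul_apply, Fin.sum_univ_two, Matrix.vecHead, Matrix.vecTail] <;>
    field_simp
  · linear_combination hz - h
  · linear_combination (-conj (a : ℂ)) * hz
  · linear_combination (-(a : ℂ)) * hz
  · linear_combination (a * conj (a : ℂ)) * hz + h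

lemma transfer_conj_form (α : ℤ → Complex.UnitDisc) {z : ℂ} (hz : z * conj z = 1) (N : ℕ) :
    transfer α z N * !![1, 0; 0, -1] * (transfer α z N)ᴴ = !![1, 0; 0, -1] := by
  induction N with
  | zero => simp [transfer]
  | succ N ih =>
    rw [transfer, Matrix.conjTranspose_mul,
      show ∀ A B C D E : Matrix (Fin 2) (Fin 2) ℂ, A * B * C * (D * E) = A * (B * C * D) * E from
        fun A B C D E => by noncomm_ring, ih, szego_conj_form _ hz]

/-- Differentiating one factor replaces S by S P up to z, with P = diag(1, 0). Since P = J P and J =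
A J A*, each term of the product rule can be written as the full transfer matrix times J A_k* P A_k.
-/
lemma smul_transferDeriv (α : ℤ → Complex.UnitDisc) {z : ℂ} (hz : z * conj z = 1) (N : ℕ) :
    z • transferDeriv α z N = transfer α z N * !![1, 0; 0, -1] *
      ∑ k ∈ Finset.range N, (transfer α z k)ᴴ * !![1, 0; 0, 0] * transfer α z k := by
  induction N with
  | zero => simp [transferDeriv]
  | succ N ih =>
    have h1 : z • ((1 / (ρ (α (N + 1)) : ℂ)) • !![1, 0; -(α (N + 1) : ℂ), 0])
        = szego (α (N + 1)) z * !![1, 0; 0, 0] := by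
      ext i j
      fin_cases i <;> fin_cases j <;> simp [szego, Matrix.mul_apply, Fin.sum_univ_two] <;> ring
    have h2 : (!![1, 0; 0, -1] * !![1, 0; 0, 0] : Matrix (Fin 2) (Fin 2) ℂ) = !![1, 0; 0, 0] := by
      ext i j
      fin_cases i <;> fin_cases j <;> simp
    have h3 := transfer_conj_form α hz N
    rw [transferDeriv, smul_add, ← smul_mul_assoc, h1, Finset.sum_range_succ, mul_add, transfer,
      ← mul_smul_comm, ih, add_comm]
    congr 1
    · simp only [mul_assoc]
    · rw [← h2]
      nth_rewrite 1 [← h3]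
      simp only [mul_assoc]
      nth_rewrite 3 [← mul_assoc !![1, 0; 0, -1]]
      rw [h2]

/-- Each summand is the rank-one matrix of the first row (a, b) of a transfer matrix.
Pseudo-unitarity gives |a|² - |b|² = 1, so |a| ≠ |b| and 2|a||b| < |a|² + |b|² strictly. -/
lemma exists_gram_eq (α : ℤ → Complex.UnitDisc) {z : ℂ} (hz : z * conj z = 1) (N : ℕ) :
    ∃ (t : ℝ) (p r q : ℂ), p + r = t ∧
      ∑ k ∈ Finset.range N, (transfer α z k)ᴴ * !![1, 0; 0, 0] * transfer α z k
        = !![p, q; conj q, r] ∧ 2 * ‖q‖ ≤ t ∧ (0 < N → 2 * ‖q‖ < t) := by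
  induction N with
  | zero =>
    refine ⟨0, 0, 0, 0, by simp, ?_, by simp, by simp⟩
    ext i j
    fin_cases i <;> fin_cases j <;> simp
  | succ N ih =>
    obtain ⟨t, p, r, q, h1, h2, h3, -⟩ := ih
    have h := congrFun (congrFun (transfer_conj_form α hz N) 0) 0
    set A := transfer α z N
    simp [Matrix.mul_apply, Fin.sum_univ_two] at h
    rw [Complex.mul_conj, Complex.mul_conj, Complex.normSq_eq_norm_sq,
      Complex.normSq_eq_norm_sq] at h
    have h' : ‖A 0 0‖ ^ 2 - ‖A 0 1‖ ^ 2 = 1 := by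
      rw [sub_eq_add_neg]; exact_mod_cast h
    have hlt : 2 * ‖q + conj (A 0 0) * A 0 1‖ < t + (‖A 0 0‖ ^ 2 + ‖A 0 1‖ ^ 2) := by
      have h5 := norm_add_le q (conj (A 0 0) * A 0 1)
      rw [norm_mul, RCLike.norm_conj] at h5
      have h6 : ‖A 0 0‖ - ‖A 0 1‖ ≠ 0 := fun h6 => by
        rw [sub_eq_zero.mp h6, sub_self] at h'; exact zero_ne_one h'
      nlinarith [sq_pos_of_ne_zero h6]
    refine ⟨t + (‖A 0 0‖ ^ 2 + ‖A 0 1‖ ^ 2), p + conj (A 0 0) * A 0 0, r + conj (A 0 1) * A 0 1,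
      q + conj (A 0 0) * A 0 1, ?_, ?_, hlt.le, fun _ => hlt⟩
    · rw [mul_comm (conj _), mul_comm (conj _), Complex.mul_conj, Complex.mul_conj,
        Complex.normSq_eq_norm_sq, Complex.normSq_eq_norm_sq]
      push_cast
      linear_combination h1
    · rw [Finset.sum_range_succ, h2]
      ext i j
      fin_cases i <;> fin_cases j <;>
        simp [Matrix.mul_apply, Fin.sum_univ_two, A] <;> ring

/-- If both traces vanished, A₀₀ t = A₀₁ q̄ - A₁₀ q with t the trace and q the off-diagonal entry of
G. But |A₁₀| = |A₀₁| < |A₀₀| and 2|q| < t, so the left side is strictly larger in modulus. -/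
lemma transferDeriv_trace_ne_zero {α : ℤ → Complex.UnitDisc} {z : ℂ} {N : ℕ} (hN : 0 < N)
    (h : discr α N z = 0) : (transferDeriv α z N).trace ≠ 0 := by
  have hz : z * conj z = 1 := by
    rw [Complex.mul_conj, Complex.normSq_eq_norm_sq, norm_eq_one_of_discr_eq_zero hN h]; simp
  intro h0
  have h1 := congrArg Matrix.trace (smul_transferDeriv α hz N)
  obtain ⟨t, p, r, q, hpr, hG, -, hlt⟩ := exists_gram_eq α hz N
  have hlt := hlt hN
  rw [Matrix.trace_smul, h0, smul_zero, hG] at h1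
  have hf := transfer_conj_form α hz N
  have hf0 := congrFun (congrFun hf 0) 0
  have hf1 := congrFun (congrFun hf 1) 1
  rw [discr, Matrix.trace_fin_two] at h
  set A := transfer α z N
  have hA : A 1 1 = - A 0 0 := by linear_combination h
  simp [Matrix.mul_apply, Fin.sum_univ_two, hA] at hf0 hf1
  simp only [Complex.mul_conj, Complex.normSq_eq_norm_sq] at hf0 hf1
  have hf0 : ‖A 0 0‖ ^ 2 + -‖A 0 1‖ ^ 2 = 1 := by exact_mod_cast hf0
  have hf1 : ‖A 1 0‖ ^ 2 + -‖A 0 0‖ ^ 2 = -1 := by exact_mod_cast hf1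
  have hbc : ‖A 1 0‖ = ‖A 0 1‖ :=
    (pow_left_inj₀ (norm_nonneg _) (norm_nonneg _) two_ne_zero).mp (by linarith)
  simp [Matrix.trace_fin_two, Matrix.mul_apply, Fin.sum_univ_two, hA] at h1
  have h2 : A 0 0 * t = A 0 1 * conj q - A 1 0 * q := by
    rw [← hpr]; linear_combination -h1
  have h3 := congrArg norm h2
  have h4 := norm_sub_le (A 0 1 * conj q) (A 1 0 * q)
  rw [← h3, norm_mul, norm_mul, norm_mul, RCLike.norm_conj, hbc, Complex.norm_real,
    Real.norm_of_nonneg ((by positivity : 0 ≤ 2 * ‖q‖).trans hlt.le)] at h4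
  have h5 : ‖A 0 1‖ < ‖A 0 0‖ := lt_of_pow_lt_pow_left₀ 2 (norm_nonneg _) (by linarith)
  nlinarith [norm_nonneg (A 0 1), norm_nonneg q]

lemma ncard_discr_zeros (α : ℤ → Complex.UnitDisc) {N : ℕ} (hN : 0 < N) :
    {z : ℂ | discr α N z = 0}.ncard = N := by
  obtain ⟨c, hc, h⟩ := exists_transfer_eq_smul α N
  obtain ⟨hm, hd⟩ := polyTransfer_trace_monic α hN
  set P := (polyTransfer α N).trace with hP
  have hev : ∀ z, discr α N z = c * P.eval z := fun z => by
    rw [discr, Matrix.trace_fin_two, h, h, hP, Matrix.trace_fin_two, Polynomial.eval_add]; ring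
  have hset : {z : ℂ | discr α N z = 0} = P.roots.toFinset := by
    ext z
    simp [hev, hc, hm.ne_zero]
  have hder : ∀ z, (transferDeriv α z N).trace = c * P.derivative.eval z := fun z => by
    have h1 : HasDerivAt (discr α N) (transferDeriv α z N).trace z := by
      have := (hasDerivAt_transfer α z N 0 0).add (hasDerivAt_transfer α z N 1 1)
      rw [← Matrix.trace_fin_two] at this
      refine this.congr_of_eventuallyEq (Eventually.of_forall fun w => ?_)
      exact Matrix.trace_fin_two _
    have h2 : HasDerivAt (discr α N) (c * P.derivative.eval z) z := by
      rw [show discr α N = fun z => c * P.eval z from funext hev]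
      exact (P.hasDerivAt z).const_mul c
    exact h1.unique h2
  have hnd : P.roots.Nodup := by
    refine Multiset.nodup_iff_count_le_one.mpr fun z => ?_
    rw [Polynomial.count_roots]
    by_contra! hlt
    obtain ⟨h1, h2⟩ := (Polynomial.one_lt_rootMultiplicity_iff_isRoot hm.ne_zero).mp hlt
    refine transferDeriv_trace_ne_zero hN ((hev z).trans ?_) ((hder z).trans ?_)
    · rw [h1.eq_zero, mul_zero]
    · rw [h2.eq_zero, mul_zero]
  rw [hset, Set.ncard_coe_finset, Multiset.toFinset_card_of_nodup hnd,
    ← (IsAlgClosed.splits P).natDegree_eq_card_roots, hd]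

/-! ### Entries of powers of the extended CMV matrix -/

lemma entry_eq_zero (α : ℤ → Complex.UnitDisc) {i j : ℤ} (h : j - i ∉ Finset.Icc (-2 : ℤ) 2) :
    entry α i j = 0 := by
  rw [Finset.mem_Icc] at h
  unfold entry
  split_ifs <;> first | omega | rfl

/-- Shifting the coefficients by one step transposes and shifts the extended CMV matrix. -/
lemma entry_shift_one (α : ℤ → Complex.UnitDisc) (i j : ℤ) :
    entry (fun n => α (n + 1)) i j = entry α (j + 1) (i + 1) := by
  by_cases h : j - i ∈ Finset.Icc (-2 : ℤ) 2
  · obtain ⟨d, rfl⟩ : ∃ d, j = i + d := ⟨j - i, by ring⟩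
    rw [add_sub_cancel_left] at h
    obtain ⟨h1, h2⟩ := Finset.mem_Icc.mp h
    have hp : Even (i + d + 1) ↔ (Even i ↔ ¬ Even d) := by
      rw [Int.even_add_one, Int.even_add]; tauto
    have hd : d = -2 ∨ d = -1 ∨ d = 0 ∨ d = 1 ∨ d = 2 := by omega
    rcases hd with rfl | rfl | rfl | rfl | rfl <;> by_cases hi : Even i <;>
      simp only [hi, even_two, even_neg, Int.not_even_one, not_true_eq_false, not_false_eq_true,
        iff_true, iff_false, Even.zero] at hp <;>
      simp only [entry, hi, hp, if_true, if_false] <;>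
      repeat' first | rw [if_pos (by omega)] | rw [if_neg (by omega)]
    all_goals ring_nf
  · rw [entry_eq_zero _ h, entry_eq_zero]
    rw [Finset.mem_Icc] at h ⊢
    omega

lemma entry_shift_two_mul (α : ℤ → Complex.UnitDisc) (m i j : ℤ) :
    entry (fun n => α (n + 2 * m)) i j = entry α (i + 2 * m) (j + 2 * m) := by
  have h1 : Even (i + 2 * m) ↔ Even i := by simp [parity_simps]
  simp only [entry, h1, show ∀ c, i + 2 * m - c = i - c + 2 * m from fun c => by ring,
    show ∀ c, i + 2 * m + c = i + c + 2 * m from fun c => by ring,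
    add_left_inj]

/-- The extended CMV matrix acting on arbitrary two-sided sequences. -/
def seqOp (α : ℤ → Complex.UnitDisc) : Module.End ℂ (ℤ → ℂ) where
  toFun u n := ∑ d ∈ Finset.Icc (-2 : ℤ) 2, entry α n (n + d) * u (n + d)
  map_add' u v := by ext n; simp [mul_add, Finset.sum_add_distrib]
  map_smul' c u := by ext n; simp [Finset.mul_sum, mul_left_comm]

lemma seqOp_apply (α : ℤ → Complex.UnitDisc) (u : ℤ → ℂ) (n : ℤ) :
    seqOp α u n = ∑ d ∈ Finset.Icc (-2 : ℤ) 2, entry α n (n + d) * u (n + d) := rfl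

/-- The entries of the `k`-th power of the extended CMV matrix. -/
def powEntry (α : ℤ → Complex.UnitDisc) (k : ℕ) (i j : ℤ) : ℂ :=
  (seqOp α ^ k) (Pi.single j 1) i

lemma powEntry_zero (α : ℤ → Complex.UnitDisc) (i j : ℤ) :
    powEntry α 0 i j = if i = j then 1 else 0 := by
  simp [powEntry, Pi.single_apply]

lemma powEntry_succ (α : ℤ → Complex.UnitDisc) (k : ℕ) (i j : ℤ) :
    powEntry α (k + 1) i j
      = ∑ d ∈ Finset.Icc (-2 : ℤ) 2, entry α i (i + d) * powEntry α k (i + d) j := by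
  rw [powEntry, pow_succ', Module.End.mul_apply, seqOp_apply]
  rfl

lemma powEntry_succ' (α : ℤ → Complex.UnitDisc) (k : ℕ) (i j : ℤ) :
    powEntry α (k + 1) i j
      = ∑ d ∈ Finset.Icc (-2 : ℤ) 2, powEntry α k i (j + d) * entry α (j + d) j := by
  have h : seqOp α (Pi.single j 1)
      = ∑ d ∈ Finset.Icc (-2 : ℤ) 2, entry α (j + d) j • (Pi.single (j + d) 1 : ℤ → ℂ) := by
    ext n
    rw [seqOp_apply, Finset.sum_apply]
    simp only [Pi.smul_apply, Pi.single_apply, smul_eq_mul, mul_ite, mul_one, mul_zero]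
    by_cases hn : j - n ∈ Finset.Icc (-2 : ℤ) 2
    · rw [Finset.sum_eq_single_of_mem (j - n) hn (fun b _ hb => if_neg (by omega)),
        Finset.sum_eq_single_of_mem (n - j) (by rw [Finset.mem_Icc] at hn ⊢; omega)
          (fun b _ hb => if_neg (by omega))]
      simp
    · rw [Finset.mem_Icc] at hn
      rw [Finset.sum_eq_zero, Finset.sum_eq_zero] <;>
        · intro d hd
          rw [Finset.mem_Icc] at hd
          rw [if_neg (by omega)]
  rw [powEntry, pow_succ, Module.End.mul_apply, h, map_sum, Finset.sum_apply]
  refine Finset.sum_congr rfl fun d _ => ?_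
  rw [map_smul, Pi.smul_apply, smul_eq_mul, mul_comm]
  rfl

lemma powEntry_shift_one (α : ℤ → Complex.UnitDisc) (k : ℕ) (i j : ℤ) :
    powEntry (fun n => α (n + 1)) k i j = powEntry α k (j + 1) (i + 1) := by
  induction k generalizing i j with
  | zero => simp [powEntry_zero, eq_comm]
  | succ k ih =>
    rw [powEntry_succ, powEntry_succ']
    refine Finset.sum_congr rfl fun d _ => ?_
    rw [ih, entry_shift_one, mul_comm, add_right_comm]

/-- The transposition caused by a one-step shift is invisible on the diagonal, so diagonal entries
are covariant under odd shifts as well as even ones. -/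
lemma powEntry_diag_shift (α : ℤ → Complex.UnitDisc) (k m : ℕ) (j : ℤ) :
    powEntry (fun n => α (n + m)) k j j = powEntry α k (j + m) (j + m) := by
  induction m generalizing j with
  | zero => simp
  | succ m ih =>
    have h := powEntry_shift_one (fun n => α (n + m)) k j j
    rw [ih] at h
    push_cast
    rw [← add_assoc, add_right_comm j, ← h]
    congr 1
    ext n
    rw [add_right_comm, add_assoc]

lemma entry_congr {α β : ℤ → Complex.UnitDisc} {i : ℤ} (h : ∀ n, |n - i| ≤ 2 → α n = β n) (j : ℤ) :
    entry α i j = entry β i j := by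
  unfold entry
  rw [h i (by simp), h (i - 1) (by simp), h (i + 1) (by simp), h (i - 2) (by simp)]

/-- Finite propagation: the matrix has bandwidth 2, and the entries in a row involve only
coefficients at distance at most 2. -/
lemma seqOp_pow_congr {α β : ℤ → Complex.UnitDisc} {u v : ℤ → ℂ} {k : ℕ} {i : ℤ}
    (hα : ∀ n, |n - i| ≤ 2 * k → α n = β n) (hu : ∀ n, |n - i| ≤ 2 * k → u n = v n) :
    (seqOp α ^ k) u i = (seqOp β ^ k) v i := by
  induction k generalizing i with
  | zero => exact hu i (by simp)
  | succ k ih =>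
    simp only [pow_succ', Module.End.mul_apply, seqOp_apply]
    push_cast at hα hu
    refine Finset.sum_congr rfl fun d hd => ?_
    rw [Finset.mem_Icc] at hd
    have hn : ∀ n, |n - (i + d)| ≤ 2 * (k : ℤ) → |n - i| ≤ 2 * ((k : ℤ) + 1) := fun n hn => by
      rw [abs_le] at hn ⊢; omega
    rw [entry_congr (fun n hn => hα n (hn.trans (by omega))),
      ih (fun n h => hα n (hn n h)) (fun n h => hu n (hn n h))]

lemma powEntry_congr {α β : ℤ → Complex.UnitDisc} {k : ℕ} {i : ℤ}
    (hα : ∀ n, |n - i| ≤ 2 * k → α n = β n) (j : ℤ) : powEntry α k i j = powEntry β k i j :=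
  seqOp_pow_congr hα fun _ _ => rfl

lemma norm_powEntry_le (α : ℤ → Complex.UnitDisc) (k : ℕ) (i j : ℤ) : ‖powEntry α k i j‖ ≤ 5 ^ k := by
  induction k generalizing i with
  | zero =>
    rw [powEntry_zero]
    split_ifs <;> simp
  | succ k ih =>
    rw [powEntry_succ]
    refine (norm_sum_le_of_le _ (n := fun _ => 5 ^ k) fun d _ => ?_).trans ?_
    · rw [norm_mul]
      exact (mul_le_of_le_one_left (norm_nonneg _) (norm_entry_le _ _ _)).trans (ih _)
    · simp [pow_succ, mul_comm]

/-- The entry powers depend continuously on the coefficients. -/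
lemma continuous_powEntry {Ω : Type*} [TopologicalSpace Ω] {α : Ω → ℤ → Complex.UnitDisc}
    (hα : ∀ n, Continuous fun ω => α ω n) (k : ℕ) (i j : ℤ) :
    Continuous fun ω => powEntry (α ω) k i j := by
  have hc : ∀ n, Continuous fun ω => (α ω n : ℂ) := fun n =>
    Complex.UnitDisc.continuous_coe.comp (hα n)
  have hρ : ∀ n, Continuous fun ω => (ρ (α ω n) : ℂ) := fun n =>
    Complex.continuous_ofReal.comp ((continuous_const.sub ((hc n).norm.pow 2)).sqrt)
  have hconj : ∀ n, Continuous fun ω => conj (α ω n : ℂ) := fun n =>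
    Complex.continuous_conj.comp (hc n)
  have he : ∀ i j, Continuous fun ω => entry (α ω) i j := fun i j => by
    unfold entry
    split_ifs <;> fun_prop (disch := assumption)
  induction k generalizing i with
  | zero => simpa only [powEntry_zero] using continuous_const
  | succ k ih =>
    simp only [powEntry_succ]
    exact continuous_finsetSum _ fun d _ => (he _ _).mul (ih _)

/-! ### Periodic coefficients: diagonalization on antiperiodic sequences -/

/-- The trace of a power of an operator whose eigenspaces for `Z` exhaust the space. -/
lemma trace_pow_of_eigenspaces {V : Type*} [AddCommGroup V] [Module ℂ V] [FiniteDimensional ℂ V]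
    (f : Module.End ℂ V) (Z : Finset ℂ) (d : ℕ)
    (hd : ∀ ξ ∈ Z, d ≤ Module.finrank ℂ (f.eigenspace ξ))
    (hV : Module.finrank ℂ V = d * Z.card) (k : ℕ) :
    LinearMap.trace ℂ V (f ^ k) = d * ∑ ξ ∈ Z, ξ ^ k := by
  classical
  have hind : iSupIndep fun ξ : Z => f.eigenspace (ξ : ℂ) :=
    f.eigenspaces_iSupIndep.comp Subtype.val_injective
  have hinj : Function.Injective (DirectSum.coeLinearMap fun ξ : Z => f.eigenspace (ξ : ℂ)) :=
    hind.dfinsupp_lsum_injective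
  have hsum : Module.finrank ℂ (DirectSum Z fun ξ => f.eigenspace (ξ : ℂ))
      = ∑ ξ : Z, Module.finrank ℂ (f.eigenspace (ξ : ℂ)) :=
    Module.finrank_directSum ℂ _
  have hle := LinearMap.finrank_le_finrank_of_injective hinj
  have hge : d * Z.card ≤ ∑ ξ : Z, Module.finrank ℂ (f.eigenspace (ξ : ℂ)) := by
    calc d * Z.card = ∑ _ξ : Z, d := by simp [mul_comm]
      _ ≤ _ := Finset.sum_le_sum fun ξ _ => hd ξ ξ.2
  -- Independence bounds the total dimension above and the hypothesis bounds it below, so the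
  -- eigenspaces fill V and each has dimension exactly d.
  have heq : Module.finrank ℂ (DirectSum Z fun ξ => f.eigenspace (ξ : ℂ)) = Module.finrank ℂ V := by
    omega
  have hint : DirectSum.IsInternal fun ξ : Z => f.eigenspace (ξ : ℂ) :=
    ⟨hinj, (LinearMap.injective_iff_surjective_of_finrank_eq_finrank heq).mp hinj⟩
  have hdim : ∀ ξ : Z, Module.finrank ℂ (f.eigenspace (ξ : ℂ)) = d := by
    have h1 : ∑ _ξ : Z, d = ∑ ξ : Z, Module.finrank ℂ (f.eigenspace (ξ : ℂ)) := by
      rw [← hsum, heq, hV]; simp [mul_comm]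
    have h2 := (Finset.sum_eq_sum_iff_of_le fun (ξ : Z) _ => hd ξ ξ.2).mp h1
    exact fun ξ => (h2 ξ (Finset.mem_univ _)).symm
  have hpow : ∀ (ξ : ℂ) (v : V), v ∈ f.eigenspace ξ → (f ^ k) v = ξ ^ k • v := fun ξ v hv => by
    induction k with
    | zero => simp
    | succ k ih =>
      rw [pow_succ, Module.End.mul_apply, Module.End.mem_eigenspace_iff.mp hv, map_smul, ih,
        smul_smul, pow_succ']
  have hmaps : ∀ ξ : Z, Set.MapsTo (f ^ k) (f.eigenspace (ξ : ℂ)) (f.eigenspace (ξ : ℂ)) :=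
    fun ξ v hv => by
      rw [hpow ξ v hv]
      exact Submodule.smul_mem _ _ hv
  rw [LinearMap.trace_eq_sum_trace_restrict hint hmaps, Finset.mul_sum, ← Finset.sum_coe_sort Z]
  refine Finset.sum_congr rfl fun ξ _ => ?_
  have h3 : (f ^ k).restrict (hmaps ξ) = (ξ : ℂ) ^ k • LinearMap.id := by
    ext v
    exact hpow ξ v v.2
  rw [h3, map_smul, LinearMap.trace_id, hdim, smul_eq_mul, mul_comm]

lemma exists_int_orbit {V : Type*} (e : ℤ → V ≃ V) (x : V) :
    ∃ X : ℤ → V, X 0 = x ∧ ∀ n, X (n + 1) = e n (X n) := by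
  let P : ℕ → V := fun n => Nat.rec x (fun n y => e n y) n
  let Q : ℕ → V := fun n => Nat.rec x (fun n y => (e (-(n + 1))).symm y) n
  refine ⟨fun n => if 0 ≤ n then P n.toNat else Q (-n).toNat, by simp [P], fun n => ?_⟩
  rcases le_or_gt 0 n with hn | hn
  · lift n to ℕ using hn
    beta_reduce
    rw [if_pos (by omega), if_pos (by omega)]
    exact congrArg P (by omega : ((n : ℤ) + 1).toNat = n + 1)
  · obtain ⟨m, rfl⟩ : ∃ m : ℕ, n = -(m + 1) := ⟨(-n - 1).toNat, by omega⟩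
    beta_reduce
    rw [if_neg (not_le.mpr hn)]
    have h1 : Q (- -((m : ℤ) + 1)).toNat = (e (-(m + 1))).symm (Q m) :=
      congrArg Q (by omega : (- -((m : ℤ) + 1)).toNat = m + 1)
    rw [h1, Equiv.apply_symm_apply]
    cases m with
    | zero => simp [P, Q]
    | succ m =>
      rw [if_neg (by push_cast; omega)]
      exact congrArg Q (by push_cast; omega : (-(-(((m + 1 : ℕ) : ℤ) + 1) + 1)).toNat = m + 1)

lemma int_orbit_unique {V : Type*} {e : ℤ → V ≃ V} {X Y : ℤ → V} {m : ℤ} (h0 : X m = Y m)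
    (hX : ∀ n, X (n + 1) = e n (X n)) (hY : ∀ n, Y (n + 1) = e n (Y n)) : X = Y := by
  ext n
  induction n using Int.inductionOn' (b := m) with
  | zero => exact h0
  | succ k _ ih => rw [hX, hY, ih]
  | pred k _ ih =>
    have h1 := hX (k - 1)
    have h2 := hY (k - 1)
    rw [sub_add_cancel] at h1 h2
    exact (e (k - 1)).injective (by rw [← h1, ← h2, ih])

/-- The Szegő matrix as a bijection of `ℂ²`. -/
def szegoEquiv (a : Complex.UnitDisc) {z : ℂ} (hz : z ≠ 0) : (Fin 2 → ℂ) ≃ (Fin 2 → ℂ) where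
  toFun v := szego a z *ᵥ v
  invFun v := (szego a z)⁻¹ *ᵥ v
  left_inv v := by
    beta_reduce
    rw [Matrix.mulVec_mulVec, Matrix.nonsing_inv_mul _ (by rwa [det_szego, isUnit_iff_ne_zero]),
      Matrix.one_mulVec]
  right_inv v := by
    beta_reduce
    rw [Matrix.mulVec_mulVec, Matrix.mul_nonsing_inv _ (by rwa [det_szego, isUnit_iff_ne_zero]),
      Matrix.one_mulVec]

/-- `X` solves the Szegő recursion at `z`. -/
def IsSzegoSol (α : ℤ → Complex.UnitDisc) (z : ℂ) (X : ℤ → Fin 2 → ℂ) : Prop :=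
  ∀ n, X (n + 1) = szego (α n) z *ᵥ X n

lemma exists_isSzegoSol (α : ℤ → Complex.UnitDisc) {z : ℂ} (hz : z ≠ 0) (x : Fin 2 → ℂ) :
    ∃ X, IsSzegoSol α z X ∧ X 1 = x := by
  -- The orbit is anchored at index 0, whereas the initial value belongs at site 1, where the
  -- transfer matrix starts with α₁; hence the index shift.
  obtain ⟨X, h0, h⟩ := exists_int_orbit (fun n => szegoEquiv (α (n + 1)) hz) x
  refine ⟨fun n => X (n - 1), fun n => ?_, by simpa using h0⟩
  have := h (n - 1)
  rw [sub_add_cancel] at this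
  beta_reduce
  rw [add_sub_cancel_right, this]
  rfl

lemma IsSzegoSol.transfer {α : ℤ → Complex.UnitDisc} {z : ℂ} {X : ℤ → Fin 2 → ℂ}
    (h : IsSzegoSol α z X) (N : ℕ) : X (N + 1) = transfer α z N *ᵥ X 1 := by
  induction N with
  | zero => simp [CMV.transfer]
  | succ N ih =>
    rw [transfer_succ_mulVec, ← ih, ← h]
    push_cast
    rfl

lemma IsSzegoSol.shift {α : ℤ → Complex.UnitDisc} {z : ℂ} {X : ℤ → Fin 2 → ℂ}
    (h : IsSzegoSol α z X) {N : ℕ} (hα : ∀ n, α (n + N) = α n) :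
    IsSzegoSol α z fun n => X (n + N) := fun n => by
  have := h (n + N)
  rw [hα] at this
  beta_reduce
  rw [add_right_comm, this]

/-- Crossing two periods applies A² = -z^N at site 1; the translate and the multiple are solutions
with the same value there, so they agree everywhere. -/
lemma IsSzegoSol.antiperiodic {α : ℤ → Complex.UnitDisc} {z : ℂ} (hz : z ≠ 0)
    {X : ℤ → Fin 2 → ℂ} (h : IsSzegoSol α z X) {N : ℕ} (hα : ∀ n, α (n + N) = α n)
    (hD : discr α N z = 0) (n : ℤ) : X (n + 2 * N) = (-z ^ N) • X n := by
  have h1 : X (1 + N) = CMV.transfer α z N *ᵥ X 1 := by rw [add_comm, h.transfer]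
  have h2 : X (1 + N + N) = CMV.transfer α z N *ᵥ X (1 + N) := by
    rw [← (h.shift hα).transfer N, add_comm (1 : ℤ) N]
  have h3 : X (1 + 2 * N) = (-z ^ N) • X 1 := by
    rw [two_mul, ← add_assoc, h2, h1, Matrix.mulVec_mulVec, transfer_mul_self hD,
      Matrix.smul_mulVec, Matrix.one_mulVec]
  have hY : IsSzegoSol α z fun n => (-z ^ N) • X n := fun n => by
    change (-z ^ N) • X (n + 1) = _
    rw [h n, Matrix.mulVec_smul]
  have hX : IsSzegoSol α z fun n => X (n + 2 * N) := by
    have := (h.shift hα).shift hα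
    simpa only [add_assoc, ← two_mul] using this
  exact congrFun (int_orbit_unique (X := fun n => X (n + 2 * N)) (Y := fun n => (-z ^ N) • X n)
    (e := fun n => szegoEquiv (α n) hz) (m := 1) h3 hX hY) n

/-- The generalized eigenfunction of the extended CMV matrix attached to a solution of the Szegő
recursion. -/
def eigenSeq (z : ℂ) (X : ℤ → Fin 2 → ℂ) (n : ℤ) : ℂ :=
  if Even n then z ^ (-(n / 2)) * X n 0 else z ^ (-((n + 1) / 2)) * X n 1

lemma eigenSeq_even (z : ℂ) (X : ℤ → Fin 2 → ℂ) (m : ℤ) :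
    eigenSeq z X (2 * m) = z ^ (-m) * X (2 * m) 0 := by
  rw [eigenSeq, if_pos (even_two_mul m), Int.mul_ediv_cancel_left _ two_ne_zero]

lemma eigenSeq_odd (z : ℂ) (X : ℤ → Fin 2 → ℂ) (m : ℤ) :
    eigenSeq z X (2 * m + 1) = z ^ (-(m + 1)) * X (2 * m + 1) 1 := by
  rw [eigenSeq, if_neg (by simp [parity_simps]), show (2 * m + 1 + 1) / 2 = m + 1 by omega]

/-- The recursion solved for (z X₀(n), X₁(n+1)) in terms of (X₁(n), X₀(n+1)): the transfer matrix
becomes the unitary block [ᾱ, ρ; ρ, -α] from which ℰ is built. -/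
lemma IsSzegoSol.step {α : ℤ → Complex.UnitDisc} {z : ℂ} {X : ℤ → Fin 2 → ℂ}
    (h : IsSzegoSol α z X) (n : ℤ) :
    z * X n 0 = conj (α n : ℂ) * X n 1 + ρ (α n) * X (n + 1) 0 ∧
      X (n + 1) 1 = ρ (α n) * X n 1 - α n * X (n + 1) 0 := by
  have hρ := ρ_mul_self (α n)
  have h0 := ρ_ne_zero (α n)
  rw [h n, szego_mulVec]
  simp only [Matrix.cons_val_zero, Matrix.cons_val_one]
  constructor <;> field_simp
  · ring
  · linear_combination (-X n 1) * hρ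

/-- The grouping exhibits ℰ as a product: the brackets are 2×2 blocks on the pairs (2m-1, 2m) and
(2m+1, 2m+2), and the outer combination is a block on (2m, 2m+1). -/
lemma seqOp_even (α : ℤ → Complex.UnitDisc) (u : ℤ → ℂ) (m : ℤ) :
    seqOp α u (2 * m) =
      conj (α (2 * m) : ℂ) * (ρ (α (2 * m - 1)) * u (2 * m - 1) - α (2 * m - 1) * u (2 * m)) +
      ρ (α (2 * m)) * (conj (α (2 * m + 1) : ℂ) * u (2 * m + 1)
        + ρ (α (2 * m + 1)) * u (2 * m + 2)) := by
  rw [seqOp_apply, show Finset.Icc (-2 : ℤ) 2 = {-2, -1, 0, 1, 2} from rfl]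
  simp [entry]
  repeat' first | rw [if_pos (by omega)] | rw [if_neg (by omega)]
  ring_nf

lemma seqOp_odd (α : ℤ → Complex.UnitDisc) (u : ℤ → ℂ) (m : ℤ) :
    seqOp α u (2 * m + 1) =
      ρ (α (2 * m)) * (ρ (α (2 * m - 1)) * u (2 * m - 1) - α (2 * m - 1) * u (2 * m)) -
      α (2 * m) * (conj (α (2 * m + 1) : ℂ) * u (2 * m + 1)
        + ρ (α (2 * m + 1)) * u (2 * m + 2)) := by
  have hp : ¬ Even (2 * m + 1) := by simp [parity_simps]
  rw [seqOp_apply, show Finset.Icc (-2 : ℤ) 2 = {-2, -1, 0, 1, 2} from rfl]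
  simp [entry, hp]
  repeat' first | rw [if_pos (by omega)] | rw [if_neg (by omega)]
  ring_nf

lemma IsSzegoSol.seqOp_eigenSeq {α : ℤ → Complex.UnitDisc} {z : ℂ} (hz : z ≠ 0)
    {X : ℤ → Fin 2 → ℂ} (h : IsSzegoSol α z X) : seqOp α (eigenSeq z X) = z • eigenSeq z X := by
  -- The inner blocks, evaluated by the recursion at odd sites, return the components of X that the
  -- eigensequence omits; the outer block then uses the recursion at even sites.
  have key : ∀ m : ℤ,
      (ρ (α (2 * m - 1)) : ℂ) * eigenSeq z X (2 * m - 1) - α (2 * m - 1) * eigenSeq z X (2 * m)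
        = z ^ (-m) * X (2 * m) 1 ∧
      conj (α (2 * m + 1) : ℂ) * eigenSeq z X (2 * m + 1)
        + ρ (α (2 * m + 1)) * eigenSeq z X (2 * m + 2) = z ^ (-m) * X (2 * m + 1) 0 := fun m => by
    have h1 := (h.step (2 * m - 1)).2
    have h2 := (h.step (2 * m + 1)).1
    have e1 := eigenSeq_odd z X (m - 1)
    have e2 := eigenSeq_even z X (m + 1)
    rw [show 2 * (m - 1) + 1 = 2 * m - 1 by ring, sub_add_cancel] at e1
    rw [show 2 * (m + 1) = 2 * m + 2 by ring] at e2
    rw [sub_add_cancel] at h1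
    rw [show 2 * m + 1 + 1 = 2 * m + 2 by ring] at h2
    have hzz : z ^ (-(m + 1)) * z = z ^ (-m) := by
      rw [← zpow_add_one₀ hz]; congr 1; ring
    rw [e1, e2, eigenSeq_even, eigenSeq_odd, h1, ← hzz]
    constructor
    · ring
    · linear_combination (-z ^ (-(m + 1))) * h2
  ext n
  rw [Pi.smul_apply, smul_eq_mul]
  obtain ⟨m, rfl | rfl⟩ := Int.even_or_odd' n
  · rw [seqOp_even, (key m).1, (key m).2, eigenSeq_even]
    linear_combination (-z ^ (-m)) * (h.step (2 * m)).1
  · have hzz : z ^ (-m) = z ^ (-(m + 1)) * z := by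
      rw [← zpow_add_one₀ hz]; congr 1; ring
    rw [seqOp_odd, (key m).1, (key m).2, eigenSeq_odd, hzz]
    linear_combination (-z ^ (-(m + 1)) * z) * (h.step (2 * m)).2

/-- The prefactor gains z^(-N) over 2N sites, cancelling z^N and leaving a sign independent of z, so
all zeros share one space of sequences. -/
lemma eigenSeq_antiperiodic {z : ℂ} (hz : z ≠ 0) {X : ℤ → Fin 2 → ℂ} {N : ℕ}
    (h : ∀ n, X (n + 2 * N) = (-z ^ N) • X n) (n : ℤ) :
    eigenSeq z X (n + 2 * N) = - eigenSeq z X n := by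
  have hzz : ∀ m : ℤ, z ^ (-(m + N)) * z ^ N = z ^ (-m) := fun m => by
    rw [← zpow_natCast z N, ← zpow_add₀ hz]; congr 1; ring
  obtain ⟨m, rfl | rfl⟩ := Int.even_or_odd' n
  · rw [← mul_add, eigenSeq_even, eigenSeq_even, mul_add, h, ← hzz m]
    simp only [Pi.smul_apply, smul_eq_mul]
    ring
  · have h1 := h (2 * m + 1)
    rw [show 2 * m + 1 + 2 * (N : ℤ) = 2 * (m + N) + 1 by ring] at h1 ⊢
    rw [eigenSeq_odd, eigenSeq_odd, h1, ← hzz (m + 1), add_right_comm m N 1]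
    simp only [Pi.smul_apply, smul_eq_mul]
    ring

/-- The sequences `u` with `u (n + M) = - u n`. -/
def antiperiodic (M : ℕ) : Submodule ℂ (ℤ → ℂ) where
  carrier := {u | ∀ n, u (n + M) = - u n}
  add_mem' {u v} hu hv n := by
    change ∀ n, _ = _ at hu hv
    simp only [Pi.add_apply, hu, hv]; ring
  zero_mem' n := by simp
  smul_mem' c u hu n := by
    change ∀ n, _ = _ at hu
    simp only [Pi.smul_apply, hu, smul_neg]

lemma antiperiodic_add_mul {M : ℕ} {u : ℤ → ℂ} (hu : u ∈ antiperiodic M) (r q : ℤ) :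
    u (r + M * q) = (-1) ^ q * u r := by
  induction q using Int.induction_on with
  | zero => simp
  | succ k ih =>
    have := hu (r + M * k)
    rw [mul_add, mul_one, ← add_assoc, this, ih, zpow_add_one₀ (by norm_num)]
    ring
  | pred k ih =>
    have := hu (r + M * (-k - 1))
    rw [show r + (M : ℤ) * (-k - 1) + M = r + M * -k by ring, ih] at this
    rw [zpow_sub_one₀ (by norm_num), mul_right_comm, this]
    norm_num

/-- Antiperiodic sequences are determined by one period. -/
def antiperiodicEquiv {M : ℕ} (hM : 0 < M) : antiperiodic M ≃ₗ[ℂ] (Fin M → ℂ) where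
  toFun u j := (u : ℤ → ℂ) (j : ℕ)
  map_add' _ _ := rfl
  map_smul' _ _ := rfl
  invFun w := ⟨fun n => (-1) ^ (n / M) * w ⟨(n % M).toNat, by
      have := Int.emod_lt_of_pos n (by exact_mod_cast hM : (0 : ℤ) < M); omega⟩, fun n => by
    have hM' : (M : ℤ) ≠ 0 := by exact_mod_cast hM.ne'
    simp only [Int.add_emod_right]
    rw [Int.add_ediv_of_dvd_right (dvd_refl _), Int.ediv_self hM', zpow_add_one₀ (by norm_num)]
    ring⟩
  left_inv u := by
    have hM' : (M : ℤ) ≠ 0 := by exact_mod_cast hM.ne'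
    ext n
    simp only
    rw [Int.toNat_of_nonneg (Int.emod_nonneg n hM'), ← antiperiodic_add_mul u.2,
      Int.emod_add_mul_ediv]
  right_inv w := by
    ext j
    have h1 : ((j : ℕ) : ℤ) / M = 0 := Int.ediv_eq_zero_of_lt (by omega) (by omega)
    have h2 : ((j : ℕ) : ℤ) % M = (j : ℕ) := Int.emod_eq_of_lt (by omega) (by omega)
    simp [h1, h2]

lemma finrank_antiperiodic {M : ℕ} (hM : 0 < M) : Module.finrank ℂ (antiperiodic M) = M := by
  rw [(antiperiodicEquiv hM).finrank_eq, Module.finrank_fin_fun]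

lemma trace_antiperiodic {M : ℕ} (hM : 0 < M) (F : Module.End ℂ (antiperiodic M)) :
    LinearMap.trace ℂ _ F
      = ∑ j : Fin M, (F ((antiperiodicEquiv hM).symm (Pi.single j 1)) : ℤ → ℂ) (j : ℕ) := by
  rw [LinearMap.trace_eq_matrix_trace ℂ (Module.Basis.ofEquivFun (antiperiodicEquiv hM)),
    Matrix.trace]
  refine Finset.sum_congr rfl fun j _ => ?_
  rw [Matrix.diag_apply, LinearMap.toMatrix_apply, Module.Basis.coe_ofEquivFun,
    Module.Basis.ofEquivFun_repr_apply]
  rfl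

/-- The antiperiodic extension of a point mass is supported on a residue class mod M, which meets
the window |n - j| < M only at j. -/
lemma antiperiodicEquiv_symm_single {M : ℕ} (hM : 0 < M) (j : Fin M) (n : ℤ)
    (hn : |n - (j : ℕ)| < M) :
    ((antiperiodicEquiv hM).symm (Pi.single j 1) : ℤ → ℂ) n
      = (Pi.single ((j : ℕ) : ℤ) 1 : ℤ → ℂ) n := by
  change (-1) ^ (n / M) * (Pi.single j 1 : Fin M → ℂ) ⟨(n % M).toNat, _⟩ = _
  rw [Pi.single_apply, Pi.single_apply]
  have hM' : (M : ℤ) ≠ 0 := by exact_mod_cast hM.ne'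
  by_cases h : n = (j : ℕ)
  · subst h
    have h1 : ((j : ℕ) : ℤ) / M = 0 := Int.ediv_eq_zero_of_lt (by omega) (by omega)
    have h2 : ((j : ℕ) : ℤ) % M = (j : ℕ) := Int.emod_eq_of_lt (by omega) (by omega)
    simp [h1, h2]
  · rw [if_neg h, if_neg, mul_zero]
    intro h2
    apply h
    have h3 : (n % M).toNat = j := congrArg Fin.val h2
    have h4 := Int.emod_nonneg n hM'
    have h5 : (M : ℤ) ∣ n - (j : ℕ) :=
      Int.ModEq.dvd (show ((j : ℕ) : ℤ) % M = n % M by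
        rw [Int.emod_eq_of_lt (by omega) (by omega)]; omega)
    have := Int.eq_zero_of_abs_lt_dvd h5 hn
    omega

lemma seqOp_mem_antiperiodic {α : ℤ → Complex.UnitDisc} {N : ℕ} (hα : ∀ n, α (n + N) = α n)
    {u : ℤ → ℂ} (hu : u ∈ antiperiodic (2 * N)) : seqOp α u ∈ antiperiodic (2 * N) := fun n => by
  have hα2 : (fun n => α (n + 2 * (N : ℤ))) = α := by
    ext n; rw [two_mul, ← add_assoc, hα, hα]
  have hu' : ∀ n, u (n + 2 * N) = - u n := fun n => by simpa using hu n
  push_cast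
  rw [seqOp_apply, seqOp_apply, ← Finset.sum_neg_distrib]
  refine Finset.sum_congr rfl fun d _ => ?_
  rw [add_right_comm, hu', ← entry_shift_two_mul, hα2, mul_neg]

/-- Site 1 reads the second component, which vanishes for X and not for Y, so t = 0; site 2 reads
the first component of X, equal to z / ρ(α₁) ≠ 0, so s = 0. -/
lemma linearIndependent_eigenSeq {α : ℤ → Complex.UnitDisc} {z : ℂ} (hz : z ≠ 0)
    {X Y : ℤ → Fin 2 → ℂ} (hX : IsSzegoSol α z X)
    (hX1 : X 1 = ![1, 0]) (hY1 : Y 1 = ![0, 1]) :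
    LinearIndependent ℂ ![eigenSeq z X, eigenSeq z Y] := by
  refine LinearIndependent.pair_iff.mpr fun s t hst => ?_
  have h1 : s * eigenSeq z X (2 * 0 + 1) + t * eigenSeq z Y (2 * 0 + 1) = 0 := congrFun hst _
  have h2 : s * eigenSeq z X (2 * 1) + t * eigenSeq z Y (2 * 1) = 0 := congrFun hst _
  rw [eigenSeq_odd, eigenSeq_odd] at h1
  rw [eigenSeq_even, eigenSeq_even] at h2
  have hX2 := hX 1
  rw [hX1, szego_mulVec] at hX2
  have ht : t = 0 := by simpa [hX1, hY1, hz] using h1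
  have hX2' : X 2 0 = z / ρ (α 1) := by
    have := congrFun hX2 0
    simpa using this
  exact ⟨by simpa [ht, hX2', hz, (ρ_pos _).ne'] using h2, ht⟩

lemma two_le_finrank_eigenspace {V : Type*} [AddCommGroup V] [Module ℂ V] [FiniteDimensional ℂ V]
    (f : Module.End ℂ V) {z : ℂ} {u v : V} (hu : f u = z • u) (hv : f v = z • v)
    (h : LinearIndependent ℂ ![u, v]) : 2 ≤ Module.finrank ℂ (f.eigenspace z) := by
  have hli : LinearIndependent ℂ (![⟨u, Module.End.mem_eigenspace_iff.mpr hu⟩,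
      ⟨v, Module.End.mem_eigenspace_iff.mpr hv⟩] : Fin 2 → f.eigenspace z) := by
    refine LinearIndependent.of_comp (f.eigenspace z).subtype ?_
    convert h using 1
    ext i : 1
    fin_cases i <;> rfl
  simpa using hli.fintype_card_le_finrank

/-- The power sums of the zeros of `D_N` are sums of diagonal entries of powers of the
`N`-periodic extended CMV matrix. -/
lemma two_mul_sum_zeros_pow {α : ℤ → Complex.UnitDisc} {N : ℕ} (hα : ∀ n, α (n + N) = α n)
    {k : ℕ} (hk : k < N) {Z : Finset ℂ} (hZ : ∀ z, z ∈ Z ↔ discr α N z = 0) :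
    2 * ∑ ξ ∈ Z, ξ ^ k = ∑ j ∈ Finset.range (2 * N), powEntry α k j j := by
  have hN : 0 < N := by omega
  have hM : 0 < 2 * N := by omega
  have hf : ∀ u ∈ antiperiodic (2 * N), seqOp α u ∈ antiperiodic (2 * N) :=
    fun u hu => seqOp_mem_antiperiodic hα hu
  let F : Module.End ℂ (antiperiodic (2 * N)) := (seqOp α).restrict hf
  have : FiniteDimensional ℂ (antiperiodic (2 * N)) :=
    (antiperiodicEquiv hM).symm.finiteDimensional
  have hcard : Z.card = N := by
    rw [← ncard_discr_zeros α hN, ← Set.ncard_coe_finset]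
    congr 1
    ext z
    exact hZ z
  have hdim : ∀ ξ ∈ Z, 2 ≤ Module.finrank ℂ (F.eigenspace ξ) := fun z hz => by
    have hD := (hZ z).mp hz
    have hz0 : z ≠ 0 := fun h => by
      have := norm_eq_one_of_discr_eq_zero hN hD
      rw [h, norm_zero] at this; exact zero_ne_one this
    obtain ⟨X, hX, hX1⟩ := exists_isSzegoSol α hz0 ![1, 0]
    obtain ⟨Y, hY, hY1⟩ := exists_isSzegoSol α hz0 ![0, 1]
    have hmem : ∀ X, IsSzegoSol α z X → eigenSeq z X ∈ antiperiodic (2 * N) := fun X hX n => by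
      push_cast
      exact eigenSeq_antiperiodic hz0 (hX.antiperiodic hz0 hα hD) n
    refine two_le_finrank_eigenspace F (u := ⟨_, hmem X hX⟩) (v := ⟨_, hmem Y hY⟩)
      (Subtype.ext (hX.seqOp_eigenSeq hz0)) (Subtype.ext (hY.seqOp_eigenSeq hz0))
      (LinearIndependent.of_comp (antiperiodic (2 * N)).subtype ?_)
    convert linearIndependent_eigenSeq hz0 hX hX1 hY1 using 1
    ext i : 1
    fin_cases i <;> rfl
  have htr := trace_pow_of_eigenspaces F Z 2 hdim (by rw [finrank_antiperiodic hM, hcard]) k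
  rw [trace_antiperiodic hM] at htr
  rw [← Nat.cast_two, ← htr, Finset.sum_range]
  refine Finset.sum_congr rfl fun j _ => ?_
  have hpow : ∀ w : antiperiodic (2 * N),
      ((F ^ k) w : ℤ → ℂ) = (seqOp α ^ k) (w : ℤ → ℂ) := fun w => by
    rw [Module.End.pow_restrict]
    rfl
  rw [hpow]
  -- Only sites within 2k < 2N of j matter, and there the antiperiodic basis vector coincides with a
  -- point mass.
  refine seqOp_pow_congr (fun _ _ => rfl) fun n hn => ?_
  exact antiperiodicEquiv_symm_single hM j n (by push_cast; omega)

lemma sum_zeros_pow_eq {α : ℤ → Complex.UnitDisc} {N : ℕ} (hα : ∀ n, α (n + N) = α n)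
    {k : ℕ} (hk : k < N) {Z : Finset ℂ} (hZ : ∀ z, z ∈ Z ↔ discr α N z = 0) :
    ∑ ξ ∈ Z, ξ ^ k = ∑ j ∈ Finset.range N, powEntry α k j j := by
  have h := two_mul_sum_zeros_pow hα hk hZ
  rw [two_mul N, Finset.sum_range_add] at h
  have h2 : ∀ j : ℕ, powEntry α k ((N + j : ℕ) : ℤ) ((N + j : ℕ) : ℤ) = powEntry α k j j :=
    fun j => by
      rw [Nat.cast_add, add_comm, ← powEntry_diag_shift, funext hα]
  simp only [h2] at h
  exact mul_left_cancel₀ two_ne_zero (h.trans (two_mul _).symm)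

lemma transfer_congr {α β : ℤ → Complex.UnitDisc} (z : ℂ) {N : ℕ}
    (h : ∀ n : ℤ, 1 ≤ n → n ≤ N → α n = β n) : transfer α z N = transfer β z N := by
  induction N with
  | zero => rfl
  | succ N ih =>
    push_cast at h
    rw [transfer, transfer, ih fun n h1 h2 => h n h1 (by omega), h _ (by omega) le_rfl]

/-- The power sums of the zeros of `D_N` are sums of diagonal entries of powers of the
extended CMV matrix, up to a bounded error. -/
lemma norm_sum_zeros_pow_sub_le (α : ℤ → Complex.UnitDisc) {N k : ℕ} (hk : k < N) {Z : Finset ℂ}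
    (hZ : ∀ z, z ∈ Z ↔ discr α N z = 0) :
    ‖∑ ξ ∈ Z, ξ ^ k - ∑ j ∈ Finset.range N, powEntry α k j j‖ ≤ (4 * k + 1) * (2 * 5 ^ k) := by
  have hN : (N : ℤ) ≠ 0 := by omega
  -- The N-periodic sequence equal to α on 1, …, N, the only coefficients that D_N involves; the
  -- zeros are therefore unchanged.
  set β : ℤ → Complex.UnitDisc := fun n => α ((n - 1) % N + 1) with hβ
  have hper : ∀ n, β (n + N) = β n := fun n => by
    simp only [hβ]
    rw [add_sub_right_comm, Int.add_emod_right]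
  have hαβ : ∀ n : ℤ, 1 ≤ n → n ≤ N → β n = α n := fun n h1 h2 => by
    simp only [hβ]
    rw [Int.emod_eq_of_lt (by omega) (by omega), sub_add_cancel]
  have hZβ : ∀ z, z ∈ Z ↔ discr β N z = 0 := fun z => by
    rw [hZ, discr, discr, transfer_congr z hαβ]
  rw [sum_zeros_pow_eq hper hk hZβ, ← Finset.sum_sub_distrib]
  -- The sites whose 2k-neighbourhood can leave {1, …, N}. The left piece has the extra site because
  -- the window starts at 1 while j starts at 0.
  set bad := Finset.range (2 * k + 1) ∪ Finset.Ico (N - 2 * k) N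
  have hterm : ∀ j ∈ Finset.range N, ‖powEntry β k j j - powEntry α k j j‖
      ≤ if j ∈ bad then 2 * 5 ^ k else 0 := fun j hj => by
    split_ifs with hb
    · have := norm_sub_le (powEntry β k j j) (powEntry α k j j)
      linarith [norm_powEntry_le β k j j, norm_powEntry_le α k j j]
    · rw [powEntry_congr fun n hn => ?_, sub_self, norm_zero]
      rw [Finset.mem_range] at hj
      simp only [bad, Finset.mem_union, Finset.mem_range, Finset.mem_Ico, not_or, not_and,
        not_lt] at hb
      obtain ⟨hb1, hb2⟩ := hb
      rw [abs_le] at hn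
      refine hαβ n (by omega) ?_
      by_contra! hlt
      have := hb2 (by omega)
      omega
  refine (norm_sum_le_of_le _ hterm).trans ?_
  rw [← Finset.sum_filter, Finset.sum_const, nsmul_eq_mul]
  refine mul_le_mul_of_nonneg_right ?_ (by positivity)
  have h1 : (Finset.filter (· ∈ bad) (Finset.range N)).card ≤ bad.card :=
    Finset.card_le_card fun j hj => (Finset.mem_filter.mp hj).2
  have h2 : bad.card ≤ (2 * k + 1) + (N - (N - 2 * k)) := by
    refine (Finset.card_union_le _ _).trans ?_
    rw [Finset.card_range, Nat.card_Ico]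
  exact_mod_cast (by omega : (Finset.filter (· ∈ bad) (Finset.range N)).card ≤ 4 * k + 1)

/-! ### Unitarity and the spectral functional -/

lemma weightedShift_apply (k : ℤ) (a : ℤ → ℂ) (ha : ∀ n, ‖a n‖ ≤ 1) (u : L2Z) (n : ℤ) :
    weightedShift k a ha u n = a n * u (n + k) := rfl

lemma star_weightedShift (k : ℤ) (a : ℤ → ℂ) (ha : ∀ n, ‖a n‖ ≤ 1) :
    star (weightedShift k a ha) = weightedShift (-k) (fun n => conj (a (n - k)))
      (fun _ => (RCLike.norm_conj _).trans_le (ha _)) := by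
  rw [ContinuousLinearMap.star_eq_adjoint]
  refine ((ContinuousLinearMap.eq_adjoint_iff _ _).mpr fun u v => ?_).symm
  rw [lp.inner_eq_tsum, lp.inner_eq_tsum, ← (Equiv.addRight k).tsum_eq]
  refine tsum_congr fun n => ?_
  simp only [Equiv.coe_addRight, weightedShift_apply, RCLike.inner_apply, map_mul,
    RCLike.conj_conj, add_sub_cancel_right, add_neg_cancel_right]
  ring

/-- The operator acting on each pair `(n, n + 1)` with `n + p` even by the matrix
`[conj α_n, ρ_n; ρ_n, -α_n]`. -/
def theta (α : ℤ → Complex.UnitDisc) (p : ℤ) : L2Z →L[ℂ] L2Z :=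
  weightedShift 0 (fun n => if Even (n + p) then conj (α n : ℂ) else -α (n - 1))
    (fun n => by
      split_ifs
      · exact (RCLike.norm_conj _).trans_le (α n).norm_lt_one.le
      · exact (norm_neg _).trans_le (α _).norm_lt_one.le) +
  weightedShift 1 (fun n => if Even (n + p) then (ρ (α n) : ℂ) else 0)
    (fun n => by
      split_ifs
      · exact norm_ρ_le _
      · exact norm_zero.trans_le zero_le_one) +
  weightedShift (-1) (fun n => if Even (n + p) then 0 else (ρ (α (n - 1)) : ℂ))
    (fun n => by
      split_ifs
      · exact norm_zero.trans_le zero_le_one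
      · exact norm_ρ_le _)

lemma theta_apply (α : ℤ → Complex.UnitDisc) {p n : ℤ} (h : Even (n + p)) (u : L2Z) :
    theta α p u n = conj (α n : ℂ) * u n + ρ (α n) * u (n + 1) ∧
      theta α p u (n + 1) = ρ (α n) * u n - α n * u (n + 1) := by
  have h' : ¬ Even (n + 1 + p) := by rwa [add_right_comm, Int.even_add_one, not_not]
  simp only [theta, _root_.add_apply, lp.coeFn_add, Pi.add_apply, weightedShift_apply,
    if_pos h, if_neg h', add_zero, zero_mul, add_sub_cancel_right, add_neg_cancel_right]
  exact ⟨trivial, by ring⟩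

lemma star_theta_apply (α : ℤ → Complex.UnitDisc) {p n : ℤ} (h : Even (n + p)) (u : L2Z) :
    star (theta α p) u n = α n * u n + ρ (α n) * u (n + 1) ∧
      star (theta α p) u (n + 1) = ρ (α n) * u n - conj (α n : ℂ) * u (n + 1) := by
  have h1 : ¬ Even (n + 1 + p) := by rwa [add_right_comm, Int.even_add_one, not_not]
  have h2 : ¬ Even (n - 1 + p) := by rw [sub_add_eq_add_sub, Int.even_sub_one, not_not]; exact h
  have h3 : Even (n + 1 + 1 + p) := by
    rw [show n + 1 + 1 + p = n + p + 1 + 1 by ring, Int.even_add_one, Int.even_add_one, not_not]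
    exact h
  simp only [theta, star_add, star_weightedShift, _root_.add_apply, lp.coeFn_add, Pi.add_apply,
    weightedShift_apply, if_pos h, if_neg h1, if_neg h2, if_pos h3, add_zero, sub_zero, neg_zero,
    zero_mul, map_zero, add_sub_cancel_right, add_neg_cancel_right, sub_neg_eq_add, neg_neg,
    RCLike.conj_conj, map_neg, Complex.conj_ofReal]
  exact ⟨trivial, by ring⟩

lemma ext_of_pairs (p : ℤ) {u v : L2Z}
    (h : ∀ m, Even (m + p) → u m = v m ∧ u (m + 1) = v (m + 1)) : u = v := by
  ext n
  by_cases hn : Even (n + p)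
  · exact (h n hn).1
  · have := (h (n - 1) (by rwa [sub_add_eq_add_sub, Int.even_sub_one])).2
    rwa [sub_add_cancel] at this

/-- The operator is a direct sum of 2×2 blocks, each unitary because ρ² + |α|² = 1. -/
lemma theta_mem_unitary (α : ℤ → Complex.UnitDisc) (p : ℤ) :
    theta α p ∈ unitary (L2Z →L[ℂ] L2Z) := by
  rw [Unitary.mem_iff]
  constructor <;> refine ContinuousLinearMap.ext fun u => ext_of_pairs p fun m hm => ?_ <;>
    have hρ := ρ_mul_self (α m) <;>
    rw [mul_apply_eq_comp, one_apply_eq_self]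
  · rw [(star_theta_apply α hm _).1, (star_theta_apply α hm _).2, (theta_apply α hm _).1,
      (theta_apply α hm _).2]
    constructor
    · linear_combination (u m) * hρ
    · linear_combination (u (m + 1)) * hρ
  · rw [(theta_apply α hm _).1, (theta_apply α hm _).2, (star_theta_apply α hm _).1,
      (star_theta_apply α hm _).2]
    constructor
    · linear_combination (u m) * hρ
    · linear_combination (u (m + 1)) * hρ

lemma coe_extended (α : ℤ → Complex.UnitDisc) (u : L2Z) :
    (extended α u : ℤ → ℂ) = seqOp α (u : ℤ → ℂ) := by
  ext n
  rw [extended_apply, seqOp_apply]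

lemma extended_eq_mul (α : ℤ → Complex.UnitDisc) : extended α = theta α 0 * theta α 1 := by
  ext u n
  rw [coe_extended, mul_apply_eq_comp]
  have hodd : ∀ m : ℤ, Even (2 * m - 1 + 1) := fun m => by simp
  have hodd' : ∀ m : ℤ, Even (2 * m + 1 + 1) := fun m => by simp [parity_simps]
  obtain ⟨m, rfl | rfl⟩ := Int.even_or_odd' n
  · have h1 := (theta_apply α (hodd m) u).2
    have h2 := (theta_apply α (hodd' m) u).1
    rw [sub_add_cancel] at h1
    rw [(theta_apply α (show Even (2 * m + 0) by simp) _).1, seqOp_even, h1, h2, add_assoc (2 * m)]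
    rfl
  · have h1 := (theta_apply α (hodd m) u).2
    have h2 := (theta_apply α (hodd' m) u).1
    rw [sub_add_cancel] at h1
    rw [(theta_apply α (show Even (2 * m + 0) by simp) _).2, seqOp_odd, h1, h2, add_assoc (2 * m)]
    rfl

/-- The extended CMV matrix is unitary. -/
lemma extended_mem_unitary (α : ℤ → Complex.UnitDisc) :
    extended α ∈ unitary (L2Z →L[ℂ] L2Z) := by
  rw [extended_eq_mul]
  exact mul_mem (theta_mem_unitary α 0) (theta_mem_unitary α 1)

/-- The spectrum of a unitary operator, as a part of the circle. -/
def spectrumToCircle {U : L2Z →L[ℂ] L2Z} (hU : U ∈ unitary (L2Z →L[ℂ] L2Z)) :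
    C(spectrum ℂ U, Circle) where
  toFun x := ⟨x, spectrum.subset_circle_of_unitary hU x.2⟩
  continuous_toFun := Continuous.subtype_mk continuous_subtype_val _

lemma isStarNormal_of_mem_unitary {U : L2Z →L[ℂ] L2Z} (hU : U ∈ unitary (L2Z →L[ℂ] L2Z)) :
    IsStarNormal U :=
  ⟨(Unitary.mem_iff.mp hU).1.trans (Unitary.mem_iff.mp hU).2.symm⟩

/-- The functional calculus of a unitary operator on the continuous functions on the circle. -/
def circleHom {U : L2Z →L[ℂ] L2Z} (hU : U ∈ unitary (L2Z →L[ℂ] L2Z)) :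
    C(Circle, ℂ) →⋆ₐ[ℂ] (L2Z →L[ℂ] L2Z) :=
  (cfcHom (isStarNormal_of_mem_unitary hU)).comp
    (ContinuousMap.compStarAlgHom' ℂ ℂ (spectrumToCircle hU))

/-- The default value 0 off the circle is never seen by the spectrum. As a star homomorphism in g,
the calculus is linear, contractive and positive. -/
lemma circleCfc_eq {U : L2Z →L[ℂ] L2Z} (hU : U ∈ unitary (L2Z →L[ℂ] L2Z)) (g : C(Circle, ℂ)) :
    circleCfc g U = circleHom hU g := by
  have hext : ∀ x : spectrum ℂ U, Function.extend ((↑) : Circle → ℂ) g 0 x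
      = g (spectrumToCircle hU x) := fun x =>
    Circle.coe_injective.extend_apply g 0 (spectrumToCircle hU x)
  have hc : ContinuousOn (Function.extend ((↑) : Circle → ℂ) g 0) (spectrum ℂ U) := by
    rw [continuousOn_iff_continuous_domRestrict]
    exact (g.continuous.comp (spectrumToCircle hU).continuous).congr fun x => (hext x).symm
  rw [circleCfc, cfc_apply _ U (isStarNormal_of_mem_unitary hU) hc, circleHom]
  exact congrArg _ (ContinuousMap.ext hext)

/-- The coordinate function on the circle. -/
def circleCoord : C(Circle, ℂ) := ⟨(↑), continuous_subtype_val⟩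

lemma circleHom_coord {U : L2Z →L[ℂ] L2Z} (hU : U ∈ unitary (L2Z →L[ℂ] L2Z)) :
    circleHom hU circleCoord = U := by
  refine Eq.trans ?_ (cfcHom_id (R := ℂ) (isStarNormal_of_mem_unitary hU))
  rfl

/-- The functional `g ↦ ⟨δ_0, g(ℰ) δ_0⟩`. -/
def spectralFunctional (α : ℤ → Complex.UnitDisc) : C(Circle, ℂ) →ₗ[ℂ] ℂ where
  toFun g := inner ℂ (δ 0) (circleHom (extended_mem_unitary α) g (δ 0))
  map_add' g h := by rw [map_add, _root_.add_apply, inner_add_right]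
  map_smul' c g := by
    rw [map_smul, _root_.smul_apply, inner_smul_right]; rfl

lemma inner_circleCfc (α : ℤ → Complex.UnitDisc) (g : C(Circle, ℂ)) :
    inner ℂ (δ 0) (circleCfc g (extended α) (δ 0)) = spectralFunctional α g := by
  rw [circleCfc_eq (extended_mem_unitary α)]
  rfl

lemma norm_δ (n : ℤ) : ‖δ n‖ = 1 := by
  rw [δ, lp.norm_single (by norm_num), norm_one]

lemma norm_spectralFunctional_le (α : ℤ → Complex.UnitDisc) (g : C(Circle, ℂ)) :
    ‖spectralFunctional α g‖ ≤ ‖g‖ := by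
  refine (norm_inner_le_norm (𝕜 := ℂ) (δ 0)
    (circleHom (extended_mem_unitary α) g (δ 0))).trans ?_
  rw [norm_δ, one_mul]
  refine (ContinuousLinearMap.le_opNorm _ _).trans ?_
  rw [norm_δ, mul_one]
  exact NonUnitalStarAlgHom.norm_apply_le (circleHom (extended_mem_unitary α)) g

lemma spectralFunctional_star (α : ℤ → Complex.UnitDisc) (g : C(Circle, ℂ)) :
    spectralFunctional α (star g) = conj (spectralFunctional α g) := by
  change inner ℂ (δ 0) (circleHom _ (star g) (δ 0)) = conj (inner ℂ (δ 0) (circleHom _ g (δ 0)))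
  rw [map_star, ContinuousLinearMap.star_eq_adjoint, ContinuousLinearMap.adjoint_inner_right,
    inner_conj_symm]

lemma spectralFunctional_star_mul_self (α : ℤ → Complex.UnitDisc) (g : C(Circle, ℂ)) :
    0 ≤ (spectralFunctional α (star g * g)).re := by
  change 0 ≤ (inner ℂ (δ 0) (circleHom _ (star g * g) (δ 0)) : ℂ).re
  rw [map_mul, map_star, mul_apply_eq_comp, ContinuousLinearMap.star_eq_adjoint,
    ContinuousLinearMap.adjoint_inner_right]
  exact inner_self_nonneg (𝕜 := ℂ)

lemma coe_extended_pow (α : ℤ → Complex.UnitDisc) (k : ℕ) (u : L2Z) :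
    ((extended α ^ k) u : ℤ → ℂ) = (seqOp α ^ k) (u : ℤ → ℂ) := by
  induction k with
  | zero => rfl
  | succ k ih =>
    rw [pow_succ', pow_succ', mul_apply_eq_comp, coe_extended, ih,
      Module.End.mul_apply]

lemma spectralFunctional_coord_pow (α : ℤ → Complex.UnitDisc) (k : ℕ) :
    spectralFunctional α (circleCoord ^ k) = powEntry α k 0 0 := by
  change inner ℂ (δ 0) (circleHom _ (circleCoord ^ k) (δ 0)) = _
  have hδ : (δ 0 : ℤ → ℂ) = Pi.single 0 1 := by
    ext n
    simp [δ, lp.single_apply]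
  rw [map_pow, circleHom_coord, powEntry, ← hδ, ← coe_extended_pow]
  conv_lhs => rw [δ, lp.inner_single_left]
  simp [δ]

/-! ### Density of trigonometric polynomials -/

lemma star_circleCoord_mul_self : star circleCoord * circleCoord = 1 := by
  ext z
  change conj (z : ℂ) * z = 1
  rw [mul_comm, Complex.mul_conj, Circle.normSq_coe, Complex.ofReal_one]

/-- The monomials `z ^ k` and `conj z ^ k` on the circle. -/
def circleMonomials : Set C(Circle, ℂ) :=
  Set.range (fun k : ℕ => circleCoord ^ k) ∪ Set.range (fun k : ℕ => star circleCoord ^ k)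

lemma circleMonomials_mul_mem {g h : C(Circle, ℂ)} (hg : g ∈ circleMonomials)
    (hh : h ∈ circleMonomials) : g * h ∈ circleMonomials := by
  have key : ∀ m n : ℕ, star circleCoord ^ m * circleCoord ^ n ∈ circleMonomials := fun m n => by
    rcases le_total m n with hmn | hmn
    · refine Or.inl ⟨n - m, ?_⟩
      obtain ⟨d, rfl⟩ := Nat.exists_eq_add_of_le hmn
      simp only [add_tsub_cancel_left]
      rw [pow_add, ← mul_assoc, ← mul_pow, star_circleCoord_mul_self, one_pow, one_mul]
    · refine Or.inr ⟨m - n, ?_⟩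
      obtain ⟨d, rfl⟩ := Nat.exists_eq_add_of_le hmn
      simp only [add_tsub_cancel_left]
      rw [pow_add, mul_right_comm, ← mul_pow, star_circleCoord_mul_self, one_pow, one_mul]
  rcases hg with ⟨m, rfl⟩ | ⟨m, rfl⟩ <;> rcases hh with ⟨n, rfl⟩ | ⟨n, rfl⟩
  · exact Or.inl ⟨m + n, pow_add _ _ _⟩
  · simp only
    rw [mul_comm]
    exact key n m
  · exact key m n
  · exact Or.inr ⟨m + n, pow_add _ _ _⟩

lemma adjoin_circleCoord_le {g : C(Circle, ℂ)} (hg : g ∈ StarAlgebra.adjoin ℂ {circleCoord}) :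
    g ∈ Submodule.span ℂ circleMonomials := by
  induction hg using StarAlgebra.adjoin_induction with
  | mem x hx =>
    rw [Set.mem_singleton_iff.mp hx]
    exact Submodule.subset_span (Or.inl ⟨1, pow_one _⟩)
  | algebraMap r =>
    rw [Algebra.algebraMap_eq_smul_one]
    exact Submodule.smul_mem _ _ (Submodule.subset_span (Or.inl ⟨0, pow_zero _⟩))
  | add x y _ _ hx hy => exact Submodule.add_mem _ hx hy
  | mul x y _ _ hx hy =>
    have h := Submodule.mul_mem_mul hx hy
    rw [Submodule.span_mul_span] at h
    refine Submodule.span_mono ?_ h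
    rintro _ ⟨a, ha, b, hb, rfl⟩
    exact circleMonomials_mul_mem ha hb
  | star x hx' hx =>
    clear hx'
    induction hx using Submodule.span_induction with
    | mem x hx =>
      refine Submodule.subset_span ?_
      rcases hx with ⟨k, rfl⟩ | ⟨k, rfl⟩
      · exact Or.inr ⟨k, (star_pow _ _).symm⟩
      · exact Or.inl ⟨k, by simp only [star_pow, star_star]⟩
    | zero => rw [star_zero]; exact Submodule.zero_mem _
    | add x y _ _ hx hy => rw [star_add]; exact Submodule.add_mem _ hx hy
    | smul c x _ hx => rw [star_smul]; exact Submodule.smul_mem _ _ hx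

/-- A property of continuous functions on the circle which holds for monomials and is stable under
linear combinations and uniform limits holds for all continuous functions. -/
theorem circle_dense_induction {p : C(Circle, ℂ) → Prop} (pow : ∀ k : ℕ, p (circleCoord ^ k))
    (star_pow : ∀ k : ℕ, p (star circleCoord ^ k)) (add : ∀ g h, p g → p h → p (g + h))
    (smul : ∀ (c : ℂ) g, p g → p (c • g))
    (lim : ∀ g, (∀ ε > 0, ∃ h, p h ∧ ‖g - h‖ < ε) → p g) (g : C(Circle, ℂ)) : p g := by
  have hspan : ∀ h ∈ Submodule.span ℂ circleMonomials, p h := fun h hh => by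
    induction hh using Submodule.span_induction with
    | mem x hx =>
      rcases hx with ⟨k, rfl⟩ | ⟨k, rfl⟩
      · exact pow k
      · exact star_pow k
    | zero => simpa using smul 0 _ (pow 0)
    | add x y _ _ hx hy => exact add x y hx hy
    | smul c x _ hx => exact smul c x hx
  have hdense := ContinuousMap.starSubalgebra_topologicalClosure_eq_top_of_separatesPoints
    (StarAlgebra.adjoin ℂ {circleCoord}) (by
      intro x y hxy
      exact ⟨circleCoord, ⟨circleCoord, StarAlgebra.subset_adjoin ℂ _ rfl, rfl⟩,
        fun h => hxy (Circle.coe_injective h)⟩)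
  refine lim g fun ε hε => ?_
  have hg : g ∈ closure ((StarAlgebra.adjoin ℂ {circleCoord} : StarSubalgebra ℂ C(Circle, ℂ)) :
      Set C(Circle, ℂ)) := by
    rw [← StarSubalgebra.topologicalClosure_coe, hdense]
    trivial
  obtain ⟨h, hh, hgh⟩ := Metric.mem_closure_iff.mp hg ε hε
  exact ⟨h, hspan h (adjoin_circleCoord_le hh), by rwa [← dist_eq_norm]⟩

/-- On monomials the functional is a matrix entry, continuous in the coefficients, or its conjugate.
The bound by ‖g‖ does not depend on the coefficients, so approximation in g is uniform in ω. -/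
lemma continuous_spectralFunctional {Ω : Type*} [TopologicalSpace Ω]
    {α : Ω → ℤ → Complex.UnitDisc} (hα : ∀ n, Continuous fun ω => α ω n) (g : C(Circle, ℂ)) :
    Continuous fun ω => spectralFunctional (α ω) g := by
  induction g using circle_dense_induction with
  | pow k =>
    simp only [spectralFunctional_coord_pow]
    exact continuous_powEntry hα k 0 0
  | star_pow k =>
    simp only [← star_pow, spectralFunctional_star, spectralFunctional_coord_pow]
    exact Complex.continuous_conj.comp (continuous_powEntry hα k 0 0)
  | add g h hg hh => simp only [map_add]; exact hg.add hh
  | smul c g hg => simp only [map_smul]; exact hg.const_smul c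
  | lim g hg =>
    refine continuous_of_uniform_approx_of_continuous fun u hu => ?_
    obtain ⟨ε, hε, hεu⟩ := Metric.mem_uniformity_dist.mp hu
    obtain ⟨h, hh, hgh⟩ := hg ε hε
    refine ⟨_, hh, fun ω => hεu ?_⟩
    rw [dist_eq_norm, ← map_sub]
    exact (norm_spectralFunctional_le _ _).trans_lt hgh

/-! ### Riesz representation and weak convergence of the zero measures -/

/-- A continuous real function, as a complex one. -/
def ofRealMap {X : Type*} [TopologicalSpace X] (f : C(X, ℝ)) : C(X, ℂ) :=
  ⟨fun x => (f x : ℂ), Complex.continuous_ofReal.comp f.continuous⟩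

/-- The Riesz representation theorem for positive functionals on the continuous complex functions
on a compact space. -/
theorem exists_finiteMeasure_of_positive {X : Type*} [TopologicalSpace X] [CompactSpace X]
    [T2Space X] [MeasurableSpace X] [BorelSpace X] (φ : C(X, ℂ) →ₗ[ℂ] ℂ)
    (hstar : ∀ g, φ (star g) = conj (φ g)) (hpos : ∀ g, 0 ≤ (φ (star g * g)).re) :
    ∃ κ : FiniteMeasure X, ∀ g : C(X, ℂ), ∫ x, g x ∂(κ : Measure X) = φ g := by
  let Λ₀ : CompactlySupportedContinuousMap X ℝ →ₗ[ℝ] ℝ :=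
    { toFun := fun f => (φ (ofRealMap f.toContinuousMap)).re
      map_add' := fun f g => by
        rw [← Complex.add_re, ← map_add]
        congr 2
        ext x
        exact Complex.ofReal_add _ _
      map_smul' := fun c f => by
        have : ofRealMap (c • f).toContinuousMap = (c : ℂ) • ofRealMap f.toContinuousMap := by
          ext x
          exact Complex.ofReal_mul _ _
        rw [this, map_smul]
        simp }
  have hΛ₀ : ∀ f, 0 ≤ f → 0 ≤ Λ₀ f := fun f hf => by
    -- A nonnegative function is star h * h with h its square root, which brings in the positivity
    -- hypothesis.
    have h : ofRealMap f.toContinuousMap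
        = star (ofRealMap ⟨fun x => √(f x), f.continuous.sqrt⟩)
          * ofRealMap ⟨fun x => √(f x), f.continuous.sqrt⟩ := by
      ext x
      change (f x : ℂ) = conj ((√(f x) : ℝ) : ℂ) * ((√(f x) : ℝ) : ℂ)
      rw [Complex.conj_ofReal, ← Complex.ofReal_mul, Real.mul_self_sqrt (hf x)]
    change 0 ≤ (φ (ofRealMap f.toContinuousMap)).re
    rw [h]
    exact hpos _
  let Λ := PositiveLinearMap.mk₀ Λ₀ hΛ₀
  have hfin : IsFiniteMeasure (RealRMK.rieszMeasure Λ) := inferInstance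
  refine ⟨⟨RealRMK.rieszMeasure Λ, hfin⟩, fun g => ?_⟩
  have hreal : ∀ f : C(X, ℝ), ((∫ x, f x ∂(RealRMK.rieszMeasure Λ) : ℝ) : ℂ) = φ (ofRealMap f) :=
    fun f => by
      have h1 := RealRMK.integral_rieszMeasure Λ (CompactlySupportedContinuousMap.continuousMapEquiv f)
      have h2 : ∫ x, f x ∂(RealRMK.rieszMeasure Λ) = (φ (ofRealMap f)).re := h1
      have h3 : star (ofRealMap f) = ofRealMap f := by
        ext x
        exact Complex.conj_ofReal _
      have h4 := hstar (ofRealMap f)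
      rw [h3] at h4
      rw [h2]
      exact Complex.conj_eq_iff_re.mp h4.symm
  have hg : g = ofRealMap ⟨fun x => (g x).re, Complex.continuous_re.comp g.continuous⟩
      + Complex.I • ofRealMap ⟨fun x => (g x).im, Complex.continuous_im.comp g.continuous⟩ := by
    ext x
    change g x = ((g x).re : ℂ) + Complex.I * ((g x).im : ℂ)
    rw [mul_comm, Complex.re_add_im]
  have hint : Integrable g (RealRMK.rieszMeasure Λ) :=
    (BoundedContinuousFunction.mkOfCompact g).integrable _
  have h5 := integral_re_add_im (𝕜 := ℂ) hint
  change ∫ x, g x ∂(RealRMK.rieszMeasure Λ) = φ g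
  rw [← h5]
  conv_rhs => rw [hg, map_add, map_smul, ← hreal, ← hreal, smul_eq_mul, mul_comm]
  rfl

/-- The inclusion of the circle into the plane. -/
def circleEmbedding : Circle ↪ ℂ := ⟨fun ξ => ξ, Circle.coe_injective⟩

lemma exists_zero_finset (α : ℤ → Complex.UnitDisc) {N : ℕ} (hN : 0 < N) :
    ∃ Z : Finset Circle, (∀ ξ : Circle, ξ ∈ Z ↔ discr α N ξ = 0) ∧
      ∀ z : ℂ, z ∈ Z.map circleEmbedding ↔ discr α N z = 0 := by
  have hfin : {z : ℂ | discr α N z = 0}.Finite :=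
    Set.finite_of_ncard_ne_zero (by rw [ncard_discr_zeros α hN]; exact hN.ne')
  have hfin' : {ξ : Circle | discr α N ξ = 0}.Finite :=
    hfin.preimage Circle.coe_injective.injOn
  refine ⟨hfin'.toFinset, fun ξ => by simp, fun z => ?_⟩
  rw [Finset.mem_map]
  constructor
  · rintro ⟨ξ, hξ, rfl⟩
    exact hfin'.mem_toFinset.mp hξ
  · intro hz
    exact ⟨⟨z, mem_sphere_zero_iff_norm.mpr (norm_eq_one_of_discr_eq_zero hN hz)⟩,
      hfin'.mem_toFinset.mpr hz, rfl⟩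

lemma card_zero_finset {α : ℤ → Complex.UnitDisc} {N : ℕ} (hN : 0 < N) {Z : Finset Circle}
    (hZ : ∀ z : ℂ, z ∈ Z.map circleEmbedding ↔ discr α N z = 0) :
    Z.card = N := by
  rw [← Finset.card_map, ← Set.ncard_coe_finset]
  refine Eq.trans ?_ (ncard_discr_zeros α hN)
  congr 1
  ext z
  exact hZ z

lemma integral_zeroMeasure {α : ℤ → Complex.UnitDisc} {N : ℕ} {Z : Finset Circle}
    (hZ : ∀ ξ : Circle, ξ ∈ Z ↔ discr α N ξ = 0) (g : C(Circle, ℂ)) :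
    ∫ ξ, g ξ ∂(zeroMeasure α N : Measure Circle) = (N : ℂ)⁻¹ * ∑ ξ ∈ Z, g ξ := by
  have hset : {ξ : Circle | discr α N ξ = 0} = (Z : Set Circle) := by
    ext ξ
    exact (hZ ξ).symm
  rw [zeroMeasure, hset, finsum_mem_coe_finset, FiniteMeasure.toMeasure_smul,
    FiniteMeasure.toMeasure_sum, integral_smul_nnreal_measure, integral_finsetSum_measure]
  · have hd : ∀ ξ : Circle, ∫ x, g x ∂((pointMass ξ : FiniteMeasure Circle) : Measure Circle)
        = g ξ := fun ξ => integral_dirac _ _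
    simp only [hd, NNReal.smul_def, Complex.real_smul]
    push_cast
    rfl
  · exact fun ξ _ => (BoundedContinuousFunction.mkOfCompact g).integrable _

lemma norm_integral_le_mass (κ : FiniteMeasure Circle) (g : C(Circle, ℂ)) :
    ‖∫ ξ, g ξ ∂(κ : Measure Circle)‖ ≤ ‖g‖ * κ.mass := by
  refine (norm_integral_le_of_norm_le_const (ae_of_all _ fun x => g.norm_coe_le_norm x)).trans_eq ?_
  rfl

lemma norm_integral_zeroMeasure_le (α : ℤ → Complex.UnitDisc) {N : ℕ} (hN : 0 < N)
    (g : C(Circle, ℂ)) : ‖∫ ξ, g ξ ∂(zeroMeasure α N : Measure Circle)‖ ≤ ‖g‖ := by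
  obtain ⟨Z, hZ, hZ'⟩ := exists_zero_finset α hN
  rw [integral_zeroMeasure hZ, norm_mul, norm_inv, Complex.norm_natCast,
    inv_mul_le_iff₀ (by exact_mod_cast hN)]
  refine (norm_sum_le_of_le _ fun ξ _ => g.norm_coe_le_norm ξ).trans ?_
  rw [Finset.sum_const, nsmul_eq_mul, card_zero_finset hN hZ']

lemma integral_sub_continuousMap (κ : FiniteMeasure Circle) (g h : C(Circle, ℂ)) :
    ∫ ξ, (g - h) ξ ∂(κ : Measure Circle)
      = ∫ ξ, g ξ ∂(κ : Measure Circle) - ∫ ξ, h ξ ∂(κ : Measure Circle) :=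
  integral_sub ((BoundedContinuousFunction.mkOfCompact g).integrable _)
    ((BoundedContinuousFunction.mkOfCompact h).integrable _)

lemma integral_add_continuousMap (κ : FiniteMeasure Circle) (g h : C(Circle, ℂ)) :
    ∫ ξ, (g + h) ξ ∂(κ : Measure Circle)
      = ∫ ξ, g ξ ∂(κ : Measure Circle) + ∫ ξ, h ξ ∂(κ : Measure Circle) :=
  integral_add ((BoundedContinuousFunction.mkOfCompact g).integrable _)
    ((BoundedContinuousFunction.mkOfCompact h).integrable _)

/-- Convergence of the moments of the zero measures implies weak convergence. -/
theorem tendsto_zeroMeasure_of_moments (α : ℤ → Complex.UnitDisc) (κ : FiniteMeasure Circle)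
    (h : ∀ k : ℕ, Tendsto (fun N => ∫ ξ, (circleCoord ^ k) ξ ∂(zeroMeasure α N : Measure Circle))
      atTop (𝓝 (∫ ξ, (circleCoord ^ k) ξ ∂(κ : Measure Circle)))) :
    Tendsto (fun N => zeroMeasure α N) atTop (𝓝 κ) := by
  refine (FiniteMeasure.tendsto_iff_forall_integral_rclike_tendsto ℂ).mpr fun g => ?_
  change Tendsto (fun N => ∫ ξ, g.toContinuousMap ξ ∂(zeroMeasure α N : Measure Circle)) atTop
    (𝓝 (∫ ξ, g.toContinuousMap ξ ∂(κ : Measure Circle)))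
  induction g.toContinuousMap using circle_dense_induction with
  | pow k => exact h k
  | star_pow k =>
    have hconj : ∀ ν : FiniteMeasure Circle, ∫ ξ, (star circleCoord ^ k) ξ ∂(ν : Measure Circle)
        = conj (∫ ξ, (circleCoord ^ k) ξ ∂(ν : Measure Circle)) := fun ν => by
      rw [← integral_conj, ← star_pow]
      rfl
    simp only [hconj]
    exact (Complex.continuous_conj.tendsto _).comp (h k)
  | add g₁ g₂ h₁ h₂ =>
    simp only [integral_add_continuousMap]
    exact h₁.add h₂
  | smul c g₁ h₁ =>
    simp only [ContinuousMap.smul_apply, integral_smul]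
    exact h₁.const_smul c
  | lim g₁ hg₁ =>
    refine Metric.tendsto_atTop.mpr fun ε hε => ?_
    have hC : (0 : ℝ) < 2 + κ.mass := by positivity
    obtain ⟨g₂, h₂, hg₂⟩ := hg₁ (ε / (2 + κ.mass)) (by positivity)
    rw [lt_div_iff₀ hC] at hg₂
    -- Replacing g₁ by g₂ costs ‖g₁ - g₂‖ against the zero measure and ‖g₁ - g₂‖ times the mass of κ
    -- against κ; this is what remains of ε.
    have hε' : 0 < ε - ‖g₁ - g₂‖ * (1 + κ.mass) := by
      nlinarith [norm_nonneg (g₁ - g₂)]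
    obtain ⟨N₀, hN₀⟩ := Metric.tendsto_atTop.mp h₂ _ hε'
    -- The bound by ‖g‖ for the zero measure is available only for N > 0.
    refine ⟨N₀ + 1, fun N hN => ?_⟩
    have e1 := hN₀ N (by omega)
    have e2 := norm_integral_zeroMeasure_le α (by omega : 0 < N) (g₁ - g₂)
    have e3 := norm_integral_le_mass κ (g₁ - g₂)
    rw [integral_sub_continuousMap, ← dist_eq_norm] at e2 e3
    rw [dist_comm] at e3
    have e4 := dist_triangle4 (∫ ξ, g₁ ξ ∂(zeroMeasure α N : Measure Circle))
      (∫ ξ, g₂ ξ ∂(zeroMeasure α N : Measure Circle)) (∫ ξ, g₂ ξ ∂(κ : Measure Circle))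
      (∫ ξ, g₁ ξ ∂(κ : Measure Circle))
    linarith

lemma tendsto_moment_sub (α : ℤ → Complex.UnitDisc) (k : ℕ) :
    Tendsto (fun N : ℕ => ∫ ξ, (circleCoord ^ k) ξ ∂(zeroMeasure α N : Measure Circle)
      - (N : ℂ)⁻¹ * ∑ j ∈ Finset.range N, powEntry α k j j) atTop (𝓝 0) := by
  have hlim : Tendsto (fun N : ℕ => (N : ℝ)⁻¹ * ((4 * k + 1) * (2 * 5 ^ k))) atTop (𝓝 0) := by
    simpa using (tendsto_inv_atTop_nhds_zero_nat (𝕜 := ℝ)).mul_const _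
  refine squeeze_zero_norm' ?_ hlim
  filter_upwards [eventually_gt_atTop k] with N hN
  obtain ⟨Z, hZ, hZ'⟩ := exists_zero_finset α (by omega : 0 < N)
  have h := norm_sum_zeros_pow_sub_le α hN hZ'
  rw [Finset.sum_map] at h
  rw [integral_zeroMeasure hZ, ← mul_sub, norm_mul, norm_inv, Complex.norm_natCast]
  exact mul_le_mul_of_nonneg_left h (by positivity)

/-! ### Dynamically defined coefficients and the density of states -/

section Ergodic

variable {Ω : Type*} [MetricSpace Ω]

lemma continuous_coeff (T : Ω ≃ₜ Ω) (f : C(Ω, Complex.UnitDisc)) (n : ℤ) :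
    Continuous fun ω => coeff T f ω n :=
  f.continuous.comp (T ^ n).continuous

lemma coeff_iterate (T : Ω ≃ₜ Ω) (f : C(Ω, Complex.UnitDisc)) (ω : Ω) (j : ℕ) :
    coeff T f (T^[j] ω) = fun n => coeff T f ω (n + j) := by
  have h : T^[j] ω = (T ^ j) ω := by
    induction j with
    | zero => rfl
    | succ j ih =>
      rw [Function.iterate_succ_apply', ih, pow_succ']
      rfl
  ext n
  rw [coeff, coeff, zpow_add, zpow_natCast, h]
  rfl

/-- Moving along the orbit shifts the coefficients, and diagonal entries of powers are shift
covariant. -/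
lemma birkhoffAverage_powEntry (T : Ω ≃ₜ Ω) (f : C(Ω, Complex.UnitDisc)) (k N : ℕ) (ω : Ω) :
    birkhoffAverage ℂ T (fun ω => powEntry (coeff T f ω) k 0 0) N ω
      = (N : ℂ)⁻¹ * ∑ j ∈ Finset.range N, powEntry (coeff T f ω) k j j := by
  rw [birkhoffAverage, birkhoffSum, smul_eq_mul]
  congr 1
  refine Finset.sum_congr rfl fun j _ => ?_
  rw [coeff_iterate, powEntry_diag_shift, zero_add]

variable [MeasurableSpace Ω] [BorelSpace Ω]

lemma integrable_spectralFunctional (T : Ω ≃ₜ Ω) (μ : Measure Ω) [IsFiniteMeasure μ]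
    (f : C(Ω, Complex.UnitDisc)) (g : C(Circle, ℂ)) :
    Integrable (fun ω => spectralFunctional (coeff T f ω) g) μ :=
  Integrable.of_bound (continuous_spectralFunctional (continuous_coeff T f) g).aestronglyMeasurable
    ‖g‖ (ae_of_all _ fun _ => norm_spectralFunctional_le _ g)

lemma isDensityOfStates_iff (T : Ω ≃ₜ Ω) (μ : Measure Ω) [IsFiniteMeasure μ]
    (f : C(Ω, Complex.UnitDisc)) (κ : FiniteMeasure Circle) :
    IsDensityOfStates T μ f κ ↔ ∀ g : C(Circle, ℂ), ∫ z, g z ∂(κ : Measure Circle)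
      = ∫ ω, spectralFunctional (coeff T f ω) g ∂μ := by
  simp only [IsDensityOfStates, inner_circleCfc]
  exact ⟨fun h g => (h g).2, fun h g => ⟨integrable_spectralFunctional T μ f g, h g⟩⟩

theorem existsUnique_isDensityOfStates (T : Ω ≃ₜ Ω) (μ : Measure Ω) [IsFiniteMeasure μ]
    (f : C(Ω, Complex.UnitDisc)) : ∃! κ : FiniteMeasure Circle, IsDensityOfStates T μ f κ := by
  have hint := integrable_spectralFunctional T μ f
  obtain ⟨κ, hκ⟩ := exists_finiteMeasure_of_positive
    { toFun := fun g => ∫ ω, spectralFunctional (coeff T f ω) g ∂μ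
      map_add' := fun g h => by
        simp only [map_add]
        exact integral_add (hint g) (hint h)
      map_smul' := fun c g => by
        simp only [map_smul]
        exact integral_smul _ _ }
    (fun g => by
      change ∫ ω, spectralFunctional (coeff T f ω) (star g) ∂μ = _
      simp only [spectralFunctional_star]
      exact integral_conj)
    (fun g => by
      have h := integral_re (𝕜 := ℂ) (hint (star g * g))
      change 0 ≤ (∫ ω, spectralFunctional (coeff T f ω) (star g * g) ∂μ).re
      refine le_of_le_of_eq ?_ h
      exact integral_nonneg fun ω => spectralFunctional_star_mul_self _ g)
  refine ⟨κ, (isDensityOfStates_iff T μ f κ).mpr hκ, fun κ' hκ' => ?_⟩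
  have hκ' := (isDensityOfStates_iff T μ f κ').mp hκ'
  -- Uniqueness via the Hausdorff weak topology: the constant sequence κ' also converges weakly to
  -- κ, since both have the same integrals of continuous functions.
  refine tendsto_nhds_unique (f := fun _ : ℕ => κ') (l := atTop) tendsto_const_nhds ?_
  refine (FiniteMeasure.tendsto_iff_forall_integral_rclike_tendsto ℂ).mpr fun g => ?_
  have h := (hκ' g.toContinuousMap).trans (hκ g.toContinuousMap).symm
  exact (tendsto_const_nhds (x := ∫ z, g z ∂(κ' : Measure Circle))).trans_eq (congrArg 𝓝 h)

theorem ae_tendsto_zeroMeasure (T : Ω ≃ₜ Ω) (μ : Measure Ω) [IsProbabilityMeasure μ]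
    (hT : Ergodic T μ) (f : C(Ω, Complex.UnitDisc)) (κ : FiniteMeasure Circle)
    (hκ : IsDensityOfStates T μ f κ) :
    ∀ᵐ ω ∂μ, Tendsto (fun N : ℕ => zeroMeasure (coeff T f ω) N) atTop (𝓝 κ) := by
  rw [isDensityOfStates_iff] at hκ
  have hcont : ∀ k : ℕ, Continuous fun ω => powEntry (coeff T f ω) k 0 0 := fun k =>
    continuous_powEntry (continuous_coeff T f) k 0 0
  -- Countably many moments suffice, so one null set serves all of them.
  have hbirk := ae_all_iff.mpr fun k : ℕ => ae_tendsto_birkhoffAverage_complex hT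
    (hcont k).measurable (Integrable.of_bound (μ := μ) (hcont k).aestronglyMeasurable (5 ^ k)
      (ae_of_all _ fun ω => norm_powEntry_le _ _ _ _))
  filter_upwards [hbirk] with ω hω
  refine tendsto_zeroMeasure_of_moments _ κ fun k => ?_
  have h := (tendsto_moment_sub (coeff T f ω) k).add (hω k)
  rw [hκ]
  simp only [birkhoffAverage_powEntry, sub_add_cancel, zero_add] at h
  simpa only [spectralFunctional_coord_pow] using h

end Ergodic

end CMV

end

theorem proposition2p6 {Ω : Type*} [MetricSpace Ω] [CompactSpace Ω] [MeasurableSpace Ω]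
    [BorelSpace Ω] (T : Ω ≃ₜ Ω) (μ : Measure Ω) [IsProbabilityMeasure μ] (hT : Ergodic T μ)
    (f : C(Ω, Complex.UnitDisc)) :
    -- `D_N(·, ω)` has exactly `N` zeros, and they lie on the unit circle
    (∀ ω : Ω, ∀ N : ℕ, 0 < N →
      {z : ℂ | CMV.discr (CMV.coeff T f ω) N z = 0}.ncard = N ∧
      ∀ z : ℂ, CMV.discr (CMV.coeff T f ω) N z = 0 → ‖z‖ = 1) ∧
    -- the density of states measure is well defined
    (∃! κ : FiniteMeasure Circle, CMV.IsDensityOfStates T μ f κ) ∧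
    -- weak convergence
    ∀ κ : FiniteMeasure Circle, CMV.IsDensityOfStates T μ f κ →
      ∀ᵐ ω ∂μ, Tendsto (fun N : ℕ => CMV.zeroMeasure (CMV.coeff T f ω) N) atTop (𝓝 κ) :=
  ⟨fun ω _ hN => ⟨CMV.ncard_discr_zeros (CMV.coeff T f ω) hN,
      fun _ hz => CMV.norm_eq_one_of_discr_eq_zero hN hz⟩,
    CMV.existsUnique_isDensityOfStates T μ f, CMV.ae_tendsto_zeroMeasure T μ hT f⟩
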